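/- Let $M$ be a smooth manifold of dimension $n\ge 3$ and let $F\colon TM\to\mathbb R$ be a Finsler metric: $F$ is continuous, positive off the zero section, satisfies $F(tv)=tF(v)$ for $t>0$, is of class $C^2$ on the complement of the zero section, and, with $E=\frac12F^2$, the matrix $g_{ij}=\partial^2E/\partial y^i\partial y^j$ is positive definite at all nonzero vectors, where $(x^i,y^i)$ are the coordinates on $TM$ induced by local coordinates $u^1,\dots,u^n$ of $M$. Let $F$ be smooth on the complement of the zero section and of a closed set $S\subset TM$ (the exceptional directions). Let $\alpha\colon M\to\mathbb R$ be smooth, let $p\in M$ with $d_p\alpha\neq0$, write $\alpha_l=\partial\alpha/\partial u^l$, and suppose that $S\cap T_pM$ is contained in a set $\mathbb R u$, $u\in T_pM$ (the case $S=\emptyset$ is that of Finsler metrics smooth on the whole complement of the zero section). Let $$G^l=\tfrac12g^{lm}\Big(y^k\frac{\partial^2E}{\partial y^m\partial x^k}-\frac{\partial E}{\partial x^m}\Big),\qquad P^l_{ijk}=-\frac{\partial^3G^l}{\partial y^i\partial y^j\partial y^k}$$ be the spray coefficients of $F$ and the mixed curvature of its Berwald connection, and let $\tilde P^l_{ijk}$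 be the mixed curvature for the conformally changed metric $\tilde F=e^{\alpha}F$. Assume that (i) the indicatrix $\{v\in T_pM: F(v)=1\}$, with the Riemannian metric induced by $g_{ij}$, has positive sectional curvature (at its points outside $S$); (ii) $\tilde P^l_{ijk}\alpha_l=P^l_{ijk}\alpha_l$ at all nonzero $v\in T_pM\setminus S$, for all $i,j,k$. Put $X^l=g^{lm}\alpha_m$ and $E_*=E\,X^l\alpha_l$ on $T_pM$. Then $E_*$ is a positive definite quadratic form on $T_pM$. Let $g^*_{ij}=\partial^2E_*/\partial y^i\partial y^j$ be the corresponding inner product on $T_pM$, $F_*=\sqrt{2E_*}$, and let $X_*(p)\in T_pM$ be the vector with components $X_*^l=g_*^{lk}\alpha_k(p)$, where $(g_*^{lk})=(g^*_{lk})^{-1}$. There is a real constant $K(p)$ such that for every nonzero $v\in T_pM$ with $v(\alpha)=0$ (that is, $v\in T_pN$, where $N$ is the level hypersurface of $\alpha$ through $p$), the function $y(t)=E(v+tX_*(p))$ is differentiable at $0$, $y(0)>0$, $F_*(v)>0$, and $$\frac{y'(0)}{y(0)}=\frac{K(p)}{F_*(v)} .$$ -/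

import Mathlib

open scoped Manifold ContDiff

noncomputable section

namespace ConformalFinsler

/-! ### Coordinate calculus -/

/-- The `i`-th partial derivative of a real function on `ℝ^m`. -/
def pd {m : ℕ} (i : Fin m) (f : EuclideanSpace ℝ (Fin m) → ℝ)
    (x : EuclideanSpace ℝ (Fin m)) : ℝ :=
  fderiv ℝ f x (EuclideanSpace.single i 1)

/-- The Hessian matrix `∂²f/∂y^i∂y^j`. -/
def hessian {m : ℕ} (f : EuclideanSpace ℝ (Fin m) → ℝ) (y : EuclideanSpace ℝ (Fin m)) :
    Matrix (Fin m) (Fin m) ℝ :=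
  Matrix.of fun i j => pd j (pd i f) y

/-! ### Sectional curvature of a Riemannian metric given in coordinates -/

/-- The Christoffel symbols `Γ^k_{ij}` of the metric `h`. -/
def christoffel {m : ℕ} (h : EuclideanSpace ℝ (Fin m) → Matrix (Fin m) (Fin m) ℝ)
    (k i j : Fin m) (x : EuclideanSpace ℝ (Fin m)) : ℝ :=
  (1 / 2) * ∑ l, (h x)⁻¹ k l *
    (pd i (fun z => h z j l) x + pd j (fun z => h z i l) x - pd l (fun z => h z i j) x)

/-- The components of the curvature tensor: `R(∂_i, ∂_j) ∂_k = ∑ l, riemann h l k i j • ∂_l`. -/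
def riemann {m : ℕ} (h : EuclideanSpace ℝ (Fin m) → Matrix (Fin m) (Fin m) ℝ)
    (l k i j : Fin m) (x : EuclideanSpace ℝ (Fin m)) : ℝ :=
  pd i (christoffel h l j k) x - pd j (christoffel h l i k) x
    + ∑ r, (christoffel h l i r x * christoffel h r j k x
          - christoffel h l j r x * christoffel h r i k x)

/-- The sectional curvature `h(R(a,b)b, a) / (h(a,a) h(b,b) - h(a,b)^2)`. -/
def sectionalCurvature {m : ℕ} (h : EuclideanSpace ℝ (Fin m) → Matrix (Fin m) (Fin m) ℝ)
    (x a b : EuclideanSpace ℝ (Fin m)) : ℝ :=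
  (∑ i, ∑ j, ∑ k, ∑ l, ∑ r, h x l r * riemann h l k i j x * a i * b j * b k * a r) /
    ((∑ i, ∑ j, h x i j * a i * a j) * (∑ i, ∑ j, h x i j * b i * b j)
      - (∑ i, ∑ j, h x i j * a i * b j) ^ 2)

/-- The pull-back of the symmetric tensor field `g` on `ℝ^n` along `φ : ℝ^m → ℝ^n`. -/
def pullbackMetric {m n : ℕ} (g : EuclideanSpace ℝ (Fin n) → Matrix (Fin n) (Fin n) ℝ)
    (φ : EuclideanSpace ℝ (Fin m) → EuclideanSpace ℝ (Fin n))
    (x : EuclideanSpace ℝ (Fin m)) : Matrix (Fin m) (Fin m) ℝ :=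
  Matrix.of fun i j => ∑ k, ∑ l, g (φ x) k l *
    pd i (fun z => φ z k) x * pd j (fun z => φ z l) x

/-! ### Finsler metrics -/

variable {n : ℕ} {M : Type*} [TopologicalSpace M] [ChartedSpace (EuclideanSpace ℝ (Fin n)) M]
  [IsManifold (𝓡 n) ∞ M]

/-- The Finslerian energy `E = F² / 2` on the tangent space `T_pM`. -/
def energy (F : TangentBundle (𝓡 n) M → ℝ) (p : M) (y : EuclideanSpace ℝ (Fin n)) : ℝ :=
  (1 / 2) * F ⟨p, y⟩ ^ 2

/-- The Riemann-Finsler metric `g_{ij} = ∂²E/∂y^i∂y^j` on `T_pM`. -/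
def metric (F : TangentBundle (𝓡 n) M → ℝ) (p : M) (y : EuclideanSpace ℝ (Fin n)) :
    Matrix (Fin n) (Fin n) ℝ :=
  hessian (energy F p) y

/-- `F` is a Finsler metric which is smooth away from the zero section and the closed set `S` of
exceptional directions, and of class `C²` on the whole complement of the zero section.
For `S = ∅` this is a Finsler metric in the usual sense. -/
structure IsFinslerMetric (F : TangentBundle (𝓡 n) M → ℝ) (S : Set (TangentBundle (𝓡 n) M)) :
    Prop where
  isClosed_exceptional : IsClosed S
  continuous : Continuous F
  pos : ∀ (p : M) (v : TangentSpace (𝓡 n) p), v ≠ 0 → 0 < F ⟨p, v⟩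
  homogeneous : ∀ (p : M) (v : TangentSpace (𝓡 n) p) (t : ℝ), 0 < t →
    F ⟨p, t • v⟩ = t * F ⟨p, v⟩
  contMDiffOn_two : ContMDiffOn (𝓡 n).tangent 𝓘(ℝ, ℝ) 2 F {w | w.2 ≠ 0}
  smooth : ContMDiffOn (𝓡 n).tangent 𝓘(ℝ, ℝ) ∞ F {w | w.2 ≠ 0 ∧ w ∉ S}
  posDef : ∀ (p : M) (v : TangentSpace (𝓡 n) p), v ≠ 0 → (metric F p v).PosDef

/-- The indicatrix `{v ∈ T_pM | F v = 1}`, with the Riemannian metric induced by `g_{ij}`, has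
positive sectional curvature (at the points outside `S`): in every local parametrization, all
sectional curvatures of the induced metric are positive. -/
def IndicatrixPositivelyCurved (F : TangentBundle (𝓡 n) M → ℝ)
    (S : Set (TangentBundle (𝓡 n) M)) (p : M) : Prop :=
  ∀ (U : Set (EuclideanSpace ℝ (Fin (n - 1))))
    (φ : EuclideanSpace ℝ (Fin (n - 1)) → EuclideanSpace ℝ (Fin n)),
    IsOpen U → ContDiffOn ℝ ∞ φ U →
    (∀ x ∈ U, Function.Injective (fderiv ℝ φ x)) →
    (∀ x ∈ U, F ⟨p, φ x⟩ = 1 ∧ (⟨p, φ x⟩ : TangentBundle (𝓡 n) M) ∉ S) →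
    ∀ x ∈ U, ∀ a b : EuclideanSpace ℝ (Fin (n - 1)), LinearIndependent ℝ ![a, b] →
      0 < sectionalCurvature (pullbackMetric (metric F p) φ) x a b

/-! ### The geodesic spray and the mixed curvature of the Berwald connection -/

/-- The energy `E(x, y)` in the coordinates `(x, y)` of the tangent bundle induced by the preferred
chart at `p`. -/
def localEnergy (F : TangentBundle (𝓡 n) M → ℝ) (p : M) (x y : EuclideanSpace ℝ (Fin n)) : ℝ :=
  (1 / 2) * F ((extChartAt (𝓡 n).tangent (⟨p, 0⟩ : TangentBundle (𝓡 n) M)).symm (x, y)) ^ 2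

/-- The geodesic spray coefficients
`G^l = (1/2) g^{lm} (y^k ∂²E/∂y^m∂x^k - ∂E/∂x^m)` in the preferred chart at `p`. -/
def spray (F : TangentBundle (𝓡 n) M → ℝ) (p : M) (l : Fin n)
    (x y : EuclideanSpace ℝ (Fin n)) : ℝ :=
  (1 / 2) * ∑ m, (hessian (localEnergy F p x) y)⁻¹ l m *
    ((∑ k, y k * pd m (fun y' => pd k (fun x' => localEnergy F p x' y') x) y)
      - pd m (fun x' => localEnergy F p x' y) x)

/-- The components `P^l_{ijk} = -∂³G^l/∂y^i∂y^j∂y^k` of the mixed curvature tensor of the Berwald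
connection at `y ∈ T_pM`, in the preferred chart at `p`. -/
def mixedCurvature (F : TangentBundle (𝓡 n) M → ℝ) (p : M) (l i j k : Fin n)
    (y : EuclideanSpace ℝ (Fin n)) : ℝ :=
  -pd k (pd j (pd i (spray F p l (extChartAt (𝓡 n) p p)))) y

/-! ### Conformal change and the associated Riemannian objects -/

/-- The conformal change `e^α F`. -/
def conformalChange (α : M → ℝ) (F : TangentBundle (𝓡 n) M → ℝ) :
    TangentBundle (𝓡 n) M → ℝ :=
  fun w => Real.exp (α w.1) * F w

/-- The partial derivatives `α_i = ∂α/∂u^i` at `p`, in the preferred chart at `p`. -/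
def dα (α : M → ℝ) (p : M) (i : Fin n) : ℝ :=
  mfderiv (𝓡 n) 𝓘(ℝ, ℝ) α p
    (show TangentSpace (𝓡 n) p from (EuclideanSpace.single i 1 : EuclideanSpace ℝ (Fin n)))

/-- The Riemann-Finsler gradient `X^l = g^{lm} α_m`. -/
def gradX (F : TangentBundle (𝓡 n) M → ℝ) (α : M → ℝ) (p : M) (l : Fin n)
    (y : EuclideanSpace ℝ (Fin n)) : ℝ :=
  ∑ m, (metric F p y)⁻¹ l m * dα α p m

/-- The associated energy `E_* = E X^l α_l` on `T_pM`. -/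
def energyStar (F : TangentBundle (𝓡 n) M → ℝ) (α : M → ℝ) (p : M)
    (y : EuclideanSpace ℝ (Fin n)) : ℝ :=
  energy F p y * ∑ l, gradX F α p l y * dα α p l

/-- The associated norm `F_* = √(2 E_*)` on `T_pM`. -/
def normStar (F : TangentBundle (𝓡 n) M → ℝ) (α : M → ℝ) (p : M)
    (y : EuclideanSpace ℝ (Fin n)) : ℝ :=
  Real.sqrt (2 * energyStar F α p y)

/-- The associated Riemannian metric `g*_{ij} = ∂²E_*/∂y^i∂y^j` at `p`. In the situation of the
theorem `E_*` is a quadratic form (this is part of its conclusion), so that the Hessian may be taken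
at any point of `T_pM`; the origin is used here. -/
def metricStar (F : TangentBundle (𝓡 n) M → ℝ) (α : M → ℝ) (p : M) :
    Matrix (Fin n) (Fin n) ℝ :=
  hessian (energyStar F α p) 0

/-- The Riemannian gradient `X_*^l = g_*^{lk} α_k` at `p`. -/
def gradStar (F : TangentBundle (𝓡 n) M → ℝ) (α : M → ℝ) (p : M) : EuclideanSpace ℝ (Fin n) :=
  WithLp.toLp 2 fun l => ∑ k, (metricStar F α p)⁻¹ l k * dα α p k

/-- The function `y(t) = E(v + t X_*(p))`. -/
def energyOnLine (F : TangentBundle (𝓡 n) M → ℝ) (α : M → ℝ) (p : M)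
    (v : EuclideanSpace ℝ (Fin n)) (t : ℝ) : ℝ :=
  energy F p (v + t • gradStar F α p)

end ConformalFinsler

end

/-!
Under the conformal change `e^α F` the spray coefficients at `p` change by `y(α) y^l - E X^l`, so
the invariance of the contracted mixed curvature says that the third derivatives of `E_*` vanish
outside the exceptional directions. These lie in a subspace of codimension at least two, whose
complement is connected and dense, and hence the homogeneous function `E_*` is a quadratic form.

Read for this inner product, the definition of `E_*` becomes a degenerate equation for `E`: the
`g`-gradient `X` of the linear form `α` satisfies `E X(α) = ½ ‖y‖²`. For unit vectors `a`, `a'`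
orthogonal to the axis `x = X_*`, the functions `E (a + t x)` and `E (a' + t x)` are compared by a
maximum principle; they agree, so `E` is invariant under the rotations about the axis. The
logarithmic derivative of `E` along `x` is therefore the same at all unit vectors orthogonal to `x`,
and homogeneity supplies the factor `F_*(v)⁻¹`.
-/

noncomputable section

namespace ConformalFinsler

/-- Positive homogeneity of degree `k`, in the convention of Finsler geometry: only the factors
`t > 0` are considered, and nothing is said about the value at the origin. -/
def IsPosHomogeneous {V W : Type*} [SMul ℝ V] [SMul ℝ W] (k : ℕ) (f : V → W) : Prop :=
  ∀ ⦃t : ℝ⦄, 0 < t → ∀ y, f (t • y) = t ^ k • f y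

namespace IsPosHomogeneous

variable {V W : Type*} [NormedAddCommGroup V] [NormedSpace ℝ V] [NormedAddCommGroup W]
  [NormedSpace ℝ W] {f : V → W} {k : ℕ} {y : V}

protected theorem fderiv (hf : IsPosHomogeneous (k + 1) f) : IsPosHomogeneous k (fderiv ℝ f) := by
  intro t ht y
  have hscale : t • fderiv ℝ f (t • y) = t • t ^ k • fderiv ℝ f y := calc
    t • fderiv ℝ f (t • y) = fderiv ℝ (fun z => f (t • z)) y := (fderiv_comp_smul t).symm
    _ = fderiv ℝ (t ^ (k + 1) • f) y := by rw [funext (hf ht)]; rfl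
    _ = t • t ^ k • fderiv ℝ f y := by
      rw [fderiv_const_smul_field, Pi.smul_apply, smul_smul, pow_succ']
  exact smul_right_injective _ ht.ne' hscale

theorem fderiv_apply_self (hf : IsPosHomogeneous k f) (hd : DifferentiableAt ℝ f y) :
    fderiv ℝ f y y = (k : ℝ) • f y := by
  have hray : HasDerivAt (fun t : ℝ => t • y) y 1 := by
    simpa using (hasDerivAt_id (1 : ℝ)).smul_const y
  have hchain : HasDerivAt (fun t : ℝ => f (t • y)) (fderiv ℝ f y y) 1 :=
    HasFDerivAt.comp_hasDerivAt 1 (by simpa using hd.hasFDerivAt) hray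
  have hpow : HasDerivAt (fun t : ℝ => t ^ k • f y) ((k : ℝ) • f y) 1 := by
    simpa using (hasDerivAt_pow k (1 : ℝ)).smul_const (f y)
  refine hchain.unique (hpow.congr_of_eventuallyEq ?_)
  filter_upwards [lt_mem_nhds one_pos] with t ht using hf ht y

theorem fderiv_fderiv_apply_self (hf : IsPosHomogeneous (k + 1) f)
    (hd : DifferentiableAt ℝ (fderiv ℝ f) y) :
    fderiv ℝ (fderiv ℝ f) y y = (k : ℝ) • fderiv ℝ f y :=
  hf.fderiv.fderiv_apply_self hd

end IsPosHomogeneous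

section SecondDerivative

open Filter Topology

variable {V : Type*} [NormedAddCommGroup V] [NormedSpace ℝ V]

theorem deriv_le_zero_of_isLocalMax {f f' : ℝ → ℝ} {a f'' : ℝ} (hmax : IsLocalMax f a)
    (hf : ∀ᶠ s in 𝓝 a, HasDerivAt f (f' s) s) (hf' : HasDerivAt f' f'' a) : f'' ≤ 0 := by
  by_contra! hpos
  have hderiv : deriv f =ᶠ[𝓝 a] f' := hf.mono fun s hs => hs.deriv
  have hderiv₂ : deriv (deriv f) a = f'' := hderiv.deriv_eq.trans hf'.deriv
  have hmin : IsLocalMin f a :=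
    isLocalMin_of_deriv_deriv_pos (hderiv₂ ▸ hpos) hmax.deriv_eq_zero hf.self_of_nhds.continuousAt
  have hconst : f =ᶠ[𝓝 a] fun _ => f a := by
    filter_upwards [hmax, hmin] with s hle hge using le_antisymm hle hge
  have hzero : deriv (deriv f) a = 0 := by
    simpa using hconst.deriv.deriv_eq
  linarith

theorem hasDerivAt_fderiv_comp {E : V → ℝ} {c c' : ℝ → V} {c'' : V} {a : ℝ}
    (hE : ContDiffAt ℝ 2 E (c a)) (hc : ∀ s, HasDerivAt c (c' s) s) (hc' : HasDerivAt c' c'' a) :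
    (∀ᶠ s in 𝓝 a, HasDerivAt (fun s => E (c s)) (fderiv ℝ E (c s) (c' s)) s) ∧
    HasDerivAt (fun s => fderiv ℝ E (c s) (c' s))
      (fderiv ℝ (fderiv ℝ E) (c a) (c' a) (c' a) + fderiv ℝ E (c a) c'') a := by
  constructor
  · have hnear : ∀ᶠ y in 𝓝 (c a), ContDiffAt ℝ 2 E y := hE.eventually (by simp)
    filter_upwards [(hc a).continuousAt.eventually hnear] with s hs
    exact (hs.differentiableAt two_ne_zero).hasFDerivAt.comp_hasDerivAt s (hc s)
  · have hd : DifferentiableAt ℝ (fderiv ℝ E) (c a) :=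
      (hE.fderiv_right (m := 1) le_rfl).differentiableAt one_ne_zero
    exact (hd.hasFDerivAt.comp_hasDerivAt a (hc a)).clm_apply hc'

theorem hasDerivAt_log_comp {E : V → ℝ} {c c' : ℝ → V} {c'' : V} {a : ℝ}
    (hE : ContDiffAt ℝ 2 E (c a)) (hne : E (c a) ≠ 0) (hc : ∀ s, HasDerivAt c (c' s) s)
    (hc' : HasDerivAt c' c'' a) :
    (∀ᶠ s in 𝓝 a,
      HasDerivAt (fun s => Real.log (E (c s))) (fderiv ℝ E (c s) (c' s) / E (c s)) s) ∧
    HasDerivAt (fun s => fderiv ℝ E (c s) (c' s) / E (c s))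
      ((fderiv ℝ (fderiv ℝ E) (c a) (c' a) (c' a) + fderiv ℝ E (c a) c'') / E (c a)
        - (fderiv ℝ E (c a) (c' a) / E (c a)) ^ 2) a := by
  obtain ⟨hfst, hsnd⟩ := hasDerivAt_fderiv_comp hE hc hc'
  constructor
  · filter_upwards [hfst, hfst.self_of_nhds.continuousAt.eventually_ne hne] with s hs hs'
      using hs.log hs'
  · convert! hsnd.div hfst.self_of_nhds hne using 1
    field_simp

end SecondDerivative

/-- Energies `F² / 2` of Minkowski norms `F` of class `C²` off the origin. -/
structure IsMinkowskiEnergy {V : Type*} [NormedAddCommGroup V] [NormedSpace ℝ V] (E : V → ℝ) :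
    Prop where
  pos : ∀ ⦃y⦄, y ≠ 0 → 0 < E y
  homogeneous : IsPosHomogeneous 2 E
  contDiffAt : ∀ ⦃y⦄, y ≠ 0 → ContDiffAt ℝ 2 E y
  hess_pos : ∀ ⦃y⦄, y ≠ 0 → ∀ ⦃z⦄, z ≠ 0 → 0 < fderiv ℝ (fderiv ℝ E) y z z

namespace IsMinkowskiEnergy

variable {V : Type*} [NormedAddCommGroup V] [NormedSpace ℝ V] {E : V → ℝ} {y : V}

theorem fderiv_apply_self (h : IsMinkowskiEnergy E) (hy : y ≠ 0) :
    fderiv ℝ E y y = 2 * E y :=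
  h.homogeneous.fderiv_apply_self ((h.contDiffAt hy).differentiableAt two_ne_zero)

theorem contDiffAt_fderiv (h : IsMinkowskiEnergy E) (hy : y ≠ 0) : ContDiffAt ℝ 1 (fderiv ℝ E) y :=
  (h.contDiffAt hy).fderiv_right le_rfl

theorem hess_apply_self (h : IsMinkowskiEnergy E) (hy : y ≠ 0) :
    fderiv ℝ (fderiv ℝ E) y y = fderiv ℝ E y := by
  simpa using h.homogeneous.fderiv_fderiv_apply_self
    ((h.contDiffAt_fderiv hy).differentiableAt one_ne_zero)

theorem hess_smul (h : IsMinkowskiEnergy E) {t : ℝ} (ht : 0 < t) (y : V) :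
    fderiv ℝ (fderiv ℝ E) (t • y) = fderiv ℝ (fderiv ℝ E) y := by
  have hfderiv : IsPosHomogeneous (0 + 1) (fderiv ℝ E) := h.homogeneous.fderiv
  simpa using IsPosHomogeneous.fderiv (W := V →L[ℝ] ℝ) hfderiv ht y

theorem hess_symm (h : IsMinkowskiEnergy E) (hy : y ≠ 0) (z w : V) :
    fderiv ℝ (fderiv ℝ E) y z w = fderiv ℝ (fderiv ℝ E) y w z :=
  (h.contDiffAt hy).isSymmSndFDerivAt (by simp) z w

theorem hess_nonneg (h : IsMinkowskiEnergy E) (hy : y ≠ 0) (z : V) :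
    0 ≤ fderiv ℝ (fderiv ℝ E) y z z := by
  rcases eq_or_ne z 0 with rfl | hz
  · simp
  · exact (h.hess_pos hy hz).le

theorem hess_apply_sq_le (h : IsMinkowskiEnergy E) (hy : y ≠ 0) (z w : V) :
    fderiv ℝ (fderiv ℝ E) y z w ^ 2 ≤
      fderiv ℝ (fderiv ℝ E) y z z * fderiv ℝ (fderiv ℝ E) y w w :=
  LinearMap.BilinForm.apply_sq_le_of_symm (fderiv ℝ (fderiv ℝ E) y).toBilinForm
    (h.hess_nonneg hy) ⟨h.hess_symm hy⟩ z w

theorem hess_add_div (h : IsMinkowskiEnergy E) (hy : y ≠ 0) (m : ℝ) (v : V) :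
    fderiv ℝ (fderiv ℝ E) y (m • y + v) (m • y + v) / E y =
      2 * m ^ 2 + 2 * m * (fderiv ℝ E y v / E y) + fderiv ℝ (fderiv ℝ E) y v v / E y := by
  have hE := (h.pos hy).ne'
  simp only [map_add, map_smul, _root_.add_apply, _root_.smul_apply, smul_eq_mul,
    h.hess_symm hy v y, h.hess_apply_self hy, h.fderiv_apply_self hy]
  field_simp
  ring

theorem continuousOn (h : IsMinkowskiEnergy E) : ContinuousOn E {0}ᶜ :=
  fun _ hy => (h.contDiffAt hy).continuousAt.continuousWithinAt

theorem continuousOn_fderiv (h : IsMinkowskiEnergy E) : ContinuousOn (fderiv ℝ E) {0}ᶜ :=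
  fun _ hy => (h.contDiffAt_fderiv hy).continuousAt.continuousWithinAt

theorem continuousOn_hess (h : IsMinkowskiEnergy E) :
    ContinuousOn (fderiv ℝ (fderiv ℝ E)) {0}ᶜ := fun _ hy =>
  ((h.contDiffAt_fderiv hy).fderiv_right (m := 0) le_rfl).continuousAt.continuousWithinAt

theorem continuousOn_log (h : IsMinkowskiEnergy E) :
    ContinuousOn (fun y => Real.log (E y)) {0}ᶜ :=
  h.continuousOn.log fun _ hy => (h.pos hy).ne'

theorem exists_forall_mul_norm_sq_le_hess [FiniteDimensional ℝ V] (h : IsMinkowskiEnergy E)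
    {K : Set V} (hK : IsCompact K) (hK0 : K ⊆ {0}ᶜ) :
    ∃ μ > 0, ∀ y ∈ K, ∀ z, μ * ‖z‖ ^ 2 ≤ fderiv ℝ (fderiv ℝ E) y z z := by
  have : ProperSpace V := FiniteDimensional.proper_real V
  have hcont : ContinuousOn (fun q : V × V => fderiv ℝ (fderiv ℝ E) q.1 q.2 q.2)
      (K ×ˢ Metric.sphere 0 1) := by
    refine ContinuousOn.clm_apply (ContinuousOn.clm_apply ?_ continuousOn_snd) continuousOn_snd
    exact (h.continuousOn_hess.mono hK0).comp continuousOn_fst fun q hq => hq.1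
  obtain ⟨μ, hμ, hle⟩ := (hK.prod (isCompact_sphere (0 : V) 1)).exists_forall_le' hcont
    fun q hq => h.hess_pos (hK0 hq.1) (ne_zero_of_mem_unit_sphere ⟨q.2, hq.2⟩)
  refine ⟨μ, hμ, fun y hy z => ?_⟩
  rcases eq_or_ne z 0 with rfl | hz
  · simp
  have hz' : ‖z‖ ≠ 0 := norm_ne_zero_iff.2 hz
  have hunit := hle (y, ‖z‖⁻¹ • z) ⟨hy, by simp [norm_smul, hz']⟩
  simp only [map_smul, _root_.smul_apply, smul_eq_mul] at hunit
  calc μ * ‖z‖ ^ 2 ≤ ‖z‖⁻¹ * (‖z‖⁻¹ * fderiv ℝ (fderiv ℝ E) y z z) * ‖z‖ ^ 2 := by gcongr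
    _ = fderiv ℝ (fderiv ℝ E) y z z := by field_simp

end IsMinkowskiEnergy

section Equator

open scoped RealInnerProductSpace

variable {V : Type*} [NormedAddCommGroup V] [InnerProductSpace ℝ V] {x a k : V}

/-- The unit vectors orthogonal to `x`: the equator of the unit sphere with respect to the axis
spanned by `x`. -/
def equator (x : V) : Set V := {a | ⟪x, a⟫ = 0 ∧ ‖a‖ = 1}

theorem norm_add_smul_sq (ha : a ∈ equator x) (t : ℝ) : ‖a + t • x‖ ^ 2 = 1 + t ^ 2 * ‖x‖ ^ 2 := by
  rw [norm_add_sq_real, inner_smul_right, real_inner_comm, ha.1, ha.2, norm_smul, mul_pow,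
    Real.norm_eq_abs, sq_abs]
  ring

theorem add_smul_ne_zero (ha : a ∈ equator x) (t : ℝ) : a + t • x ≠ 0 := by
  rw [← norm_ne_zero_iff, ← pow_ne_zero_iff two_ne_zero, norm_add_smul_sq ha]
  positivity

theorem cos_smul_add_sin_smul_mem_equator (ha : a ∈ equator x) (hk : k ∈ equator x)
    (hak : ⟪a, k⟫ = 0) (θ : ℝ) : Real.cos θ • a + Real.sin θ • k ∈ equator x := by
  refine ⟨by simp [inner_add_right, inner_smul_right, ha.1, hk.1], ?_⟩
  rw [← sq_eq_sq₀ (norm_nonneg _) zero_le_one, norm_add_sq_real]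
  simp [inner_smul_left, inner_smul_right, norm_smul, hak, ha.2, hk.2]

theorem inv_norm_smul_mem_equator {v : V} (hv : v ≠ 0) (hxv : ⟪x, v⟫ = 0) :
    ‖v‖⁻¹ • v ∈ equator x :=
  ⟨by simp [inner_smul_right, hxv], by simp [norm_smul, hv]⟩

theorem isCompact_equator [FiniteDimensional ℝ V] (x : V) : IsCompact (equator x) := by
  have : ProperSpace V := FiniteDimensional.proper_real V
  have hclosed : IsClosed {a : V | ⟪x, a⟫ = 0} :=
    isClosed_eq (by fun_prop) continuous_const
  convert! (isCompact_sphere (0 : V) 1).inter_left hclosed using 1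
  ext a
  simp [equator]

theorem exists_mem_equator_inner_eq_zero [FiniteDimensional ℝ V] (hdim : 3 ≤ Module.finrank ℝ V)
    (x a : V) : ∃ k ∈ equator x, ⟪a, k⟫ = 0 := by
  let f : V →ₗ[ℝ] ℝ × ℝ := (innerₛₗ ℝ x).prod (innerₛₗ ℝ a)
  have hker : LinearMap.ker f ≠ ⊥ := LinearMap.ker_ne_bot_of_finrank_lt (by simp; omega)
  obtain ⟨v, hv, hv0⟩ := (Submodule.ne_bot_iff _).1 hker
  obtain ⟨hxv, hav⟩ : ⟪x, v⟫ = 0 ∧ ⟪a, v⟫ = 0 := by simpa [f] using hv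
  exact ⟨_, inv_norm_smul_mem_equator hv0 hxv, by simp [inner_smul_right, hav]⟩

theorem exists_smul_mem_equator [FiniteDimensional ℝ V] (hdim : 3 ≤ Module.finrank ℝ V)
    {v : V} (hxv : ⟪x, v⟫ = 0) (hav : ⟪a, v⟫ = 0) :
    ∃ k ∈ equator x, ⟪a, k⟫ = 0 ∧ ∃ w : ℝ, v = w • k := by
  rcases eq_or_ne v 0 with rfl | hv
  · obtain ⟨k, hk, hak⟩ := exists_mem_equator_inner_eq_zero hdim x a
    exact ⟨k, hk, hak, 0, by simp⟩
  · exact ⟨_, inv_norm_smul_mem_equator hv hxv, by simp [inner_smul_right, hav], ‖v‖, by simp [hv]⟩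

theorem exists_equator_decomposition [FiniteDimensional ℝ V] (hdim : 3 ≤ Module.finrank ℝ V)
    (hx : x ≠ 0) (ha : a ∈ equator x) (X : V) (t : ℝ) :
    ∃ k ∈ equator x, ⟪a, k⟫ = 0 ∧ ∃ m w b : ℝ, X = m • (a + t • x) + (w • k + b • x) ∧
      m ^ 2 + w ^ 2 ≤ ‖X‖ ^ 2 := by
  have hax : ⟪a, x⟫ = 0 := by rw [real_inner_comm, ha.1]
  set m := ⟪a, X⟫
  set β := ⟪x, X⟫ / ⟪x, x⟫ with hβ
  obtain ⟨k, hk, hak, w, hw⟩ := exists_smul_mem_equator hdim (x := x) (a := a)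
    (v := X - m • a - β • x)
    (by simp [inner_sub_right, inner_smul_right, ha.1, hβ, hx])
    (by simp [inner_sub_right, inner_smul_right, hax, ha.2, m])
  have hX : X = m • a + w • k + β • x := by rw [← hw]; abel
  refine ⟨k, hk, hak, m, w, β - m * t, by rw [hX]; module, ?_⟩
  have hkx : ⟪k, x⟫ = 0 := by rw [real_inner_comm, hk.1]
  have hnorm : ‖X‖ ^ 2 = m ^ 2 + w ^ 2 + ‖β • x‖ ^ 2 := by
    rw [hX, norm_add_sq_real, norm_add_sq_real]
    simp [inner_add_left, inner_smul_left, inner_smul_right, hax, hkx, hak, norm_smul, ha.2, hk.2]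
  nlinarith [sq_nonneg ‖β • x‖]

end Equator

section Helix

open Filter Topology

variable {V : Type*} [NormedAddCommGroup V] [NormedSpace ℝ V] {a k x y : V} {E : V → ℝ} {t : ℝ}

/-- The logarithmic derivative of `E` at `y` in the direction `x`. -/
def logSlope (E : V → ℝ) (x y : V) : ℝ := fderiv ℝ E y x / E y

theorem IsMinkowskiEnergy.hasDerivAt_add_smul (h : IsMinkowskiEnergy E) (hy : y ≠ 0) (x : V) :
    HasDerivAt (fun t : ℝ => E (y + t • x)) (fderiv ℝ E y x) 0 := by
  have hline : HasDerivAt (fun t : ℝ => y + t • x) x 0 := by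
    simpa using ((hasDerivAt_id (0 : ℝ)).smul_const x).const_add y
  refine HasFDerivAt.comp_hasDerivAt 0 ?_ hline
  simpa using ((h.contDiffAt hy).differentiableAt two_ne_zero).hasFDerivAt

theorem fderiv_apply_div_of_add_smul (h : IsMinkowskiEnergy E) (hy : a + t • x ≠ 0) :
    fderiv ℝ E (a + t • x) a / E (a + t • x) = 2 - t * logSlope E x (a + t • x) := by
  have hE := (h.pos hy).ne'
  have heuler := h.fderiv_apply_self hy
  rw [map_add, map_smul, smul_eq_mul] at heuler
  rw [logSlope, eq_sub_iff_add_eq]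
  field_simp
  linarith

theorem fderiv_smul_add_smul_div (hk : fderiv ℝ E y k = 0) (w b : ℝ) :
    fderiv ℝ E y (w • k + b • x) / E y = b * logSlope E x y := by
  simp [logSlope, hk, mul_div_assoc]

/-- Rescaled by `s⁻¹`, the points `a + s c` converge to `c` uniformly in the unit vector `a`. -/
theorem IsMinkowskiEnergy.eventually_log_sub_log_lt (h : IsMinkowskiEnergy E) {c : V} (hc : c ≠ 0)
    {d : ℝ} (hd : 0 < d) : ∀ᶠ s : ℝ in atTop, ∀ a a' : V, ‖a‖ = 1 → ‖a'‖ = 1 →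
      Real.log (E (a + s • c)) - Real.log (E (a' + s • c)) < d := by
  have hcont : ContinuousAt (fun y => Real.log (E y)) c :=
    h.continuousOn_log.continuousAt (isOpen_compl_singleton.mem_nhds hc)
  have hnear := (hcont.eventually (Metric.ball_mem_nhds _ (half_pos hd))).and
    (isOpen_compl_singleton.eventually_mem hc)
  obtain ⟨r, hr, hball⟩ := Metric.eventually_nhds_iff_ball.1 hnear
  filter_upwards [eventually_gt_atTop r⁻¹] with s hs
  have hs0 : 0 < s := (inv_pos.2 hr).trans hs
  have hrescale : ∀ a : V, ‖a‖ = 1 →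
      |Real.log (E (a + s • c)) - (Real.log (s ^ 2) + Real.log (E c))| < d / 2 := by
    intro a ha
    have hsmall : c + s⁻¹ • a ∈ Metric.ball c r := by
      simpa [norm_smul, ha, abs_of_pos hs0] using inv_lt_of_inv_lt₀ hr hs
    obtain ⟨hlog, hne⟩ := hball _ hsmall
    have hscale : a + s • c = s • (c + s⁻¹ • a) := by
      rw [smul_add, smul_smul, mul_inv_cancel₀ hs0.ne', one_smul, add_comm]
    rw [hscale, h.homogeneous hs0, smul_eq_mul, Real.log_mul (by positivity) (h.pos hne).ne',
      add_sub_add_left_eq_sub]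
    exact hlog
  intro a a' ha ha'
  linarith [(abs_lt.1 (hrescale a ha)).2, (abs_lt.1 (hrescale a' ha')).1]

/-- The curve `s ↦ cos (w s) a + sin (w s) k + (t + b s) x`, which turns around the axis spanned by
`x` with angular velocity `w` and rises along it with velocity `b`. -/
def helix (a k x : V) (w b t s : ℝ) : V :=
  Real.cos (w * s) • a + Real.sin (w * s) • k + (t + b * s) • x

/-- The velocity of `helix`. -/
def helixVelocity (a k x : V) (w b s : ℝ) : V :=
  (-(w * Real.sin (w * s))) • a + (w * Real.cos (w * s)) • k + b • x

theorem hasDerivAt_helix (a k x : V) (w b t s : ℝ) :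
    HasDerivAt (helix a k x w b t) (helixVelocity a k x w b s) s := by
  have hangle : HasDerivAt (fun s : ℝ => w * s) w s := by
    simpa using (hasDerivAt_id s).const_mul w
  have hheight : HasDerivAt (fun s : ℝ => t + b * s) b s := by
    simpa using ((hasDerivAt_id s).const_mul b).const_add t
  convert! ((hangle.cos.smul_const a).add (hangle.sin.smul_const k)).add
    (hheight.smul_const x) using 1
  simp only [helixVelocity]
  congr 3 <;> ring

theorem hasDerivAt_helixVelocity (a k x : V) (w b : ℝ) :
    HasDerivAt (helixVelocity a k x w b) (-(w ^ 2) • a) 0 := by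
  have hangle : HasDerivAt (fun s : ℝ => w * s) w 0 := by
    simpa using (hasDerivAt_id (0 : ℝ)).const_mul w
  convert! ((((hangle.sin.const_mul w).neg).smul_const a).add
    ((hangle.cos.const_mul w).smul_const k)).add_const (b • x) using 1
  simp [sq]

theorem helix_zero (a k x : V) (w b t : ℝ) : helix a k x w b t 0 = a + t • x := by
  simp [helix]

theorem helixVelocity_zero (a k x : V) (w b : ℝ) :
    helixVelocity a k x w b 0 = w • k + b • x := by
  simp [helixVelocity]

theorem hasDerivAt_log_helix (h : IsMinkowskiEnergy E) (hy : a + t • x ≠ 0) (k : V) (w b : ℝ) :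
    ∃ φ : ℝ → ℝ, (∀ᶠ s in 𝓝 0, HasDerivAt (fun s => Real.log (E (helix a k x w b t s))) (φ s) s) ∧
      φ 0 = fderiv ℝ E (a + t • x) (w • k + b • x) / E (a + t • x) ∧
      HasDerivAt φ ((fderiv ℝ (fderiv ℝ E) (a + t • x) (w • k + b • x) (w • k + b • x)
        - w ^ 2 * fderiv ℝ E (a + t • x) a) / E (a + t • x)
        - (fderiv ℝ E (a + t • x) (w • k + b • x) / E (a + t • x)) ^ 2) 0 := by
  have hlog := hasDerivAt_log_comp (E := E) (c := helix a k x w b t) (a := 0)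
    (by simpa only [helix_zero] using h.contDiffAt hy)
    (by simpa only [helix_zero] using (h.pos hy).ne')
    (hasDerivAt_helix a k x w b t) (hasDerivAt_helixVelocity a k x w b)
  refine ⟨_, hlog.1, by simp only [helix_zero, helixVelocity_zero], ?_⟩
  have hsnd := hlog.2
  simp only [helix_zero, helixVelocity_zero, map_smul (fderiv ℝ E _) (-(w ^ 2)), smul_eq_mul,
    neg_mul, ← sub_eq_add_neg] at hsnd
  exact hsnd

theorem hasDerivAt_mul_exp (e L t b s : ℝ) :
    HasDerivAt (fun s : ℝ => e * Real.exp (L * (t + b * s)))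
      (b * (e * L * Real.exp (L * (t + b * s)))) s := by
  have hlin : HasDerivAt (fun s : ℝ => L * (t + b * s)) (L * b) s := by
    simpa using (((hasDerivAt_id s).const_mul b).const_add t).const_mul L
  convert! hlin.exp.const_mul e using 1
  ring

/-- The function `log E(a + t x) - log E(a' + t x) + e exp(L t)` to which the maximum principle is
applied; the exponential makes up for the degeneracy of the equation satisfied by `E`. -/
def barrier (E : V → ℝ) (x : V) (e L : ℝ) (q : V × V × ℝ) : ℝ :=
  Real.log (E (q.1 + q.2.2 • x)) - Real.log (E (q.2.1 + q.2.2 • x)) + e * Real.exp (L * q.2.2)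

end Helix

section Rigidity

open Filter Topology
open scoped RealInnerProductSpace

variable {V : Type*} [NormedAddCommGroup V] [InnerProductSpace ℝ V] {x a a' k k' y : V}
  {E : V → ℝ} {t e L : ℝ}

/-- Minkowski energies `E` whose associated energy `E ⬝ l(grad l)` is the Euclidean one, where
`l = ⟪x, ·⟫` and the gradient is taken with respect to the Hessian metric of `E`. -/
structure HasEuclideanAssociatedEnergy (x : V) (E : V → ℝ) : Prop extends IsMinkowskiEnergy E where
  exists_gradient : ∀ ⦃y⦄, y ≠ 0 →
    ∃ X, fderiv ℝ (fderiv ℝ E) y X = innerSL ℝ x ∧ E y * ⟪x, X⟫ = ‖y‖ ^ 2 / 2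

theorem isLocalMax_barrier_helix
    (hmax : IsLocalMaxOn (barrier E x e L) (equator x ×ˢ equator x ×ˢ Set.univ) (a, a', t))
    (ha : a ∈ equator x) (ha' : a' ∈ equator x) (hk : k ∈ equator x) (hk' : k' ∈ equator x)
    (hak : ⟪a, k⟫ = 0) (hak' : ⟪a', k'⟫ = 0) (w w' b : ℝ) :
    IsLocalMax (fun s => Real.log (E (helix a k x w b t s)) - Real.log (E (helix a' k' x w' b t s))
      + e * Real.exp (L * (t + b * s))) 0 := by
  let γ : ℝ → V × V × ℝ := fun s =>
    (Real.cos (w * s) • a + Real.sin (w * s) • k,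
      Real.cos (w' * s) • a' + Real.sin (w' * s) • k', t + b * s)
  have hγ0 : γ 0 = (a, a', t) := by simp [γ]
  have hγ : Tendsto γ (𝓝 0) (𝓝[equator x ×ˢ equator x ×ˢ Set.univ] (a, a', t)) := by
    refine tendsto_nhdsWithin_iff.2 ⟨?_, Eventually.of_forall fun s =>
      ⟨cos_smul_add_sin_smul_mem_equator ha hk hak _,
        cos_smul_add_sin_smul_mem_equator ha' hk' hak' _, Set.mem_univ _⟩⟩
    exact hγ0 ▸ (by fun_prop : Continuous γ).tendsto 0
  filter_upwards [hγ.eventually hmax] with s hs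
  simpa [barrier, helix, γ] using hs

theorem barrier_derivatives (h : IsMinkowskiEnergy E)
    (hmax : IsLocalMaxOn (barrier E x e L) (equator x ×ˢ equator x ×ˢ Set.univ) (a, a', t))
    (ha : a ∈ equator x) (ha' : a' ∈ equator x) (hk : k ∈ equator x) (hk' : k' ∈ equator x)
    (hak : ⟪a, k⟫ = 0) (hak' : ⟪a', k'⟫ = 0) (w w' b : ℝ) :
    fderiv ℝ E (a + t • x) (w • k + b • x) / E (a + t • x)
      - fderiv ℝ E (a' + t • x) (w' • k' + b • x) / E (a' + t • x)
      + b * (e * L * Real.exp (L * t)) = 0 ∧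
    ((fderiv ℝ (fderiv ℝ E) (a + t • x) (w • k + b • x) (w • k + b • x)
        - w ^ 2 * fderiv ℝ E (a + t • x) a) / E (a + t • x)
        - (fderiv ℝ E (a + t • x) (w • k + b • x) / E (a + t • x)) ^ 2)
      - ((fderiv ℝ (fderiv ℝ E) (a' + t • x) (w' • k' + b • x) (w' • k' + b • x)
        - w' ^ 2 * fderiv ℝ E (a' + t • x) a') / E (a' + t • x)
        - (fderiv ℝ E (a' + t • x) (w' • k' + b • x) / E (a' + t • x)) ^ 2)
      + b * (b * (e * L * L * Real.exp (L * t))) ≤ 0 := by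
  have hlocal := isLocalMax_barrier_helix hmax ha ha' hk hk' hak hak' w w' b
  obtain ⟨φ, hφ, hφ0, hφ'⟩ := hasDerivAt_log_helix h (add_smul_ne_zero ha t) k w b
  obtain ⟨ψ, hψ, hψ0, hψ'⟩ := hasDerivAt_log_helix h (add_smul_ne_zero ha' t) k' w' b
  have hfst : ∀ᶠ s in 𝓝 (0 : ℝ), HasDerivAt (fun s => Real.log (E (helix a k x w b t s))
      - Real.log (E (helix a' k' x w' b t s)) + e * Real.exp (L * (t + b * s)))
      (φ s - ψ s + b * (e * L * Real.exp (L * (t + b * s)))) s := by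
    filter_upwards [hφ, hψ] with s hs hs' using (hs.sub hs').add (hasDerivAt_mul_exp e L t b s)
  have hsnd := (hφ'.sub hψ').add ((hasDerivAt_mul_exp (e * L) L t b 0).const_mul b)
  have hcrit := hlocal.hasDerivAt_eq_zero hfst.self_of_nhds
  have hconc := deriv_le_zero_of_isLocalMax hlocal hfst hsnd
  simp only [mul_zero, add_zero, hφ0, hψ0] at hcrit hconc
  exact ⟨hcrit, hconc⟩

theorem barrier_critical (h : IsMinkowskiEnergy E)
    (hmax : IsLocalMaxOn (barrier E x e L) (equator x ×ˢ equator x ×ˢ Set.univ) (a, a', t))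
    (ha : a ∈ equator x) (ha' : a' ∈ equator x) (hk : k ∈ equator x) (hk' : k' ∈ equator x)
    (hak : ⟪a, k⟫ = 0) (hak' : ⟪a', k'⟫ = 0) :
    fderiv ℝ E (a + t • x) k = 0 ∧ fderiv ℝ E (a' + t • x) k' = 0 ∧
      logSlope E x (a + t • x) - logSlope E x (a' + t • x) = -(e * L * Real.exp (L * t)) := by
  have hcrit := fun w w' b => (barrier_derivatives h hmax ha ha' hk hk' hak hak' w w' b).1
  have hE := (h.pos (add_smul_ne_zero ha t)).ne'
  have hE' := (h.pos (add_smul_ne_zero ha' t)).ne'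
  refine ⟨by simpa [hE] using hcrit 1 0 0, by simpa [hE'] using hcrit 0 1 0, ?_⟩
  have := hcrit 0 0 1
  simp only [zero_smul, one_smul, zero_add, one_mul] at this
  exact eq_neg_of_add_eq_zero_left this

theorem barrier_concave (h : IsMinkowskiEnergy E)
    (hmax : IsLocalMaxOn (barrier E x e L) (equator x ×ˢ equator x ×ˢ Set.univ) (a, a', t))
    (ha : a ∈ equator x) (ha' : a' ∈ equator x) (hk : k ∈ equator x) (hk' : k' ∈ equator x)
    (hak : ⟪a, k⟫ = 0) (hak' : ⟪a', k'⟫ = 0) (w b : ℝ) :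
    (fderiv ℝ (fderiv ℝ E) (a + t • x) (w • k + b • x) (w • k + b • x) / E (a + t • x)
        - (b * logSlope E x (a + t • x)) ^ 2)
      - (fderiv ℝ (fderiv ℝ E) (a' + t • x) (w • k' + b • x) (w • k' + b • x) / E (a' + t • x)
        - (b * logSlope E x (a' + t • x)) ^ 2)
      ≤ e * L * Real.exp (L * t) * (t * w ^ 2 - L * b ^ 2) := by
  obtain ⟨hdk, hdk', hslope⟩ := barrier_critical h hmax ha ha' hk hk' hak hak'
  have hconc := (barrier_derivatives h hmax ha ha' hk hk' hak hak' w w b).2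
  rw [fderiv_smul_add_smul_div hdk, fderiv_smul_add_smul_div hdk', sub_div, sub_div,
    mul_div_assoc, mul_div_assoc, fderiv_apply_div_of_add_smul h (add_smul_ne_zero ha t),
    fderiv_apply_div_of_add_smul h (add_smul_ne_zero ha' t)] at hconc
  linear_combination hconc - w ^ 2 * t * hslope

namespace HasEuclideanAssociatedEnergy

variable {X z : V}

theorem axis_ne_zero (h : HasEuclideanAssociatedEnergy x E) (hy : y ≠ 0) : x ≠ 0 := by
  rintro rfl
  obtain ⟨X, -, hX⟩ := h.exists_gradient hy
  have hpos : 0 < ‖y‖ ^ 2 / 2 := by positivity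
  simp [← hX] at hpos

theorem inner_gradient_pos (h : HasEuclideanAssociatedEnergy x E) (hy : y ≠ 0)
    (hX : E y * ⟪x, X⟫ = ‖y‖ ^ 2 / 2) : 0 < ⟪x, X⟫ :=
  pos_of_mul_pos_right (hX ▸ by positivity) (h.pos hy).le

theorem inner_sq_mul_le (h : HasEuclideanAssociatedEnergy x E) (hy : y ≠ 0) (z : V) :
    ⟪x, z⟫ ^ 2 * E y ≤ ‖y‖ ^ 2 / 2 * fderiv ℝ (fderiv ℝ E) y z z := by
  obtain ⟨X, hX, hEX⟩ := h.exists_gradient hy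
  have hcs := h.hess_apply_sq_le hy X z
  rw [hX, innerSL_apply_apply, innerSL_apply_apply] at hcs
  calc ⟪x, z⟫ ^ 2 * E y ≤ ⟪x, X⟫ * fderiv ℝ (fderiv ℝ E) y z z * E y := by
        gcongr; exact (h.pos hy).le
    _ = ‖y‖ ^ 2 / 2 * fderiv ℝ (fderiv ℝ E) y z z := by rw [← hEX]; ring

/-- By Cauchy–Schwarz the gradient minimizes the Hessian form among the vectors with a given inner
product with `x`, and the minimum over `E` depends on `‖y‖` only. -/
theorem hess_div_le_hess_div (h : HasEuclideanAssociatedEnergy x E) {y' : V} (hy : y ≠ 0)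
    (hy' : y' ≠ 0) (hnorm : ‖y‖ ^ 2 = ‖y'‖ ^ 2) (hX : fderiv ℝ (fderiv ℝ E) y' X = innerSL ℝ x)
    (hEX : E y' * ⟪x, X⟫ = ‖y'‖ ^ 2 / 2) (hz : ⟪x, z⟫ = ⟪x, X⟫) :
    fderiv ℝ (fderiv ℝ E) y' X X / E y' ≤ fderiv ℝ (fderiv ℝ E) y z z / E y := by
  have hle := h.inner_sq_mul_le hy z
  rw [hz, hnorm, ← hEX] at hle
  rw [hX, innerSL_apply_apply, div_le_div_iff₀ (h.pos hy') (h.pos hy)]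
  refine le_of_mul_le_mul_left ?_ (h.inner_gradient_pos hy' hEX)
  linarith

theorem norm_axis_le_one (h : HasEuclideanAssociatedEnergy x E) : ‖x‖ ≤ 1 := by
  rcases eq_or_ne x 0 with rfl | hx
  · simp
  have hle := h.inner_sq_mul_le hx x
  rw [h.hess_apply_self hx, h.fderiv_apply_self hx, real_inner_self_eq_norm_sq] at hle
  have hpos : 0 < ‖x‖ ^ 2 * E x := by have := h.pos hx; positivity
  exact (sq_le_one_iff₀ (norm_nonneg x)).1 (le_of_mul_le_mul_right (by linarith) hpos)

theorem one_le_mul_fderiv (h : HasEuclideanAssociatedEnergy x E) {m w b : ℝ} (ha : a ∈ equator x)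
    (hk : k ∈ equator x) (hdk : fderiv ℝ E (a + t • x) k = 0)
    (hX : fderiv ℝ (fderiv ℝ E) (a + t • x) X = innerSL ℝ x)
    (hEX : E (a + t • x) * ⟪x, X⟫ = ‖a + t • x‖ ^ 2 / 2)
    (hdecomp : X = m • (a + t • x) + (w • k + b • x)) :
    1 ≤ b * fderiv ℝ E (a + t • x) a := by
  have hy := add_smul_ne_zero ha t
  have hx : 0 < ‖x‖ := norm_pos_iff.2 (h.axis_ne_zero hy)
  have hx1 : ‖x‖ ^ 2 ≤ 1 := pow_le_one₀ hx.le h.norm_axis_le_one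
  have hxX : ⟪x, X⟫ = (m * t + b) * ‖x‖ ^ 2 := by
    simp [hdecomp, inner_add_right, inner_smul_right, ha.1, hk.1]
    ring
  rw [hxX, norm_add_smul_sq ha] at hEX
  have hdX : fderiv ℝ E (a + t • x) X = t * ‖x‖ ^ 2 := by
    rw [← h.hess_apply_self hy, h.hess_symm hy, hX]
    simp [inner_add_right, inner_smul_right, ha.1]
  rw [hdecomp, map_add, map_add, map_smul, map_smul, map_smul, h.fderiv_apply_self hy, hdk] at hdX
  simp only [smul_eq_mul, mul_zero, zero_add] at hdX
  have heuler := h.fderiv_apply_self hy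
  rw [map_add, map_smul, smul_eq_mul] at heuler
  have hkey : b * fderiv ℝ E (a + t • x) a * ‖x‖ ^ 2
      = 1 + t ^ 2 * ‖x‖ ^ 2 * (1 - ‖x‖ ^ 2) := by
    linear_combination 2 * hEX + b * ‖x‖ ^ 2 * heuler - t * ‖x‖ ^ 2 * hdX
  have hle : 1 ≤ b * fderiv ℝ E (a + t • x) a * ‖x‖ ^ 2 := by
    rw [hkey, le_add_iff_nonneg_right]
    exact mul_nonneg (by positivity) (sub_nonneg.2 hx1)
  have hnonneg : 0 ≤ b * fderiv ℝ E (a + t • x) a :=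
    (pos_of_mul_pos_left (one_pos.trans_le hle) (by positivity)).le
  exact hle.trans (mul_le_of_le_one_right hnonneg hx1)

/-- With `X` the gradient at `a' + t x`, compare the Hessian form of `E` at `X` with the one at
`a + t x` and the vector having the same components, and cancel `e L exp(L t)`. -/
theorem exists_exponent_mul_sq_le [FiniteDimensional ℝ V] (h : HasEuclideanAssociatedEnergy x E)
    (hdim : 3 ≤ Module.finrank ℝ V)
    (hmax : IsLocalMaxOn (barrier E x e L) (equator x ×ˢ equator x ×ˢ Set.univ) (a, a', t))
    (ha : a ∈ equator x) (ha' : a' ∈ equator x) (he : 0 < e) (hL : 0 < L) :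
    ∃ X, fderiv ℝ (fderiv ℝ E) (a' + t • x) X = innerSL ℝ x ∧ ∃ m w b : ℝ,
      m ^ 2 + w ^ 2 ≤ ‖X‖ ^ 2 ∧ 1 ≤ b * fderiv ℝ E (a' + t • x) a' ∧
      L * b ^ 2 ≤ -2 * m * b + t * w ^ 2
        - b ^ 2 * (logSlope E x (a + t • x) + logSlope E x (a' + t • x)) := by
  have hy := add_smul_ne_zero ha t
  have hy' := add_smul_ne_zero ha' t
  obtain ⟨X, hX, hEX⟩ := h.exists_gradient hy'
  obtain ⟨k', hk', hak', m, w, b, hdecomp, hmw⟩ :=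
    exists_equator_decomposition hdim (h.axis_ne_zero hy) ha' X t
  obtain ⟨k, hk, hak⟩ := exists_mem_equator_inner_eq_zero hdim x a
  obtain ⟨hdk, hdk', hslope⟩ := barrier_critical h.1 hmax ha ha' hk hk' hak hak'
  refine ⟨X, hX, m, w, b, hmw, h.one_le_mul_fderiv ha' hk' hdk' hX hEX hdecomp, ?_⟩
  have hhess : fderiv ℝ (fderiv ℝ E) (a' + t • x) X X / E (a' + t • x) ≤
      fderiv ℝ (fderiv ℝ E) (a + t • x) (m • (a + t • x) + (w • k + b • x))
        (m • (a + t • x) + (w • k + b • x)) / E (a + t • x) := by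
    refine h.hess_div_le_hess_div hy hy' ?_ hX hEX ?_
    · rw [norm_add_smul_sq ha, norm_add_smul_sq ha']
    · simp [hdecomp, inner_add_right, inner_smul_right, ha.1, ha'.1, hk.1, hk'.1]
  rw [hdecomp, h.hess_add_div hy', h.hess_add_div hy, fderiv_smul_add_smul_div hdk,
    fderiv_smul_add_smul_div hdk'] at hhess
  have hconc := barrier_concave h.1 hmax ha ha' hk hk' hak hak' w b
  set g := e * L * Real.exp (L * t)
  have hg : 0 < g := by positivity
  refine le_of_mul_le_mul_left ?_ hg
  linear_combination hhess + hconc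
    + (2 * m * b + b ^ 2 * (logSlope E x (a + t • x) + logSlope E x (a' + t • x))) * hslope

end HasEuclideanAssociatedEnergy

theorem exponent_le {m w b s p p' M Z : ℝ} (hZ : 0 ≤ Z) (ht : |t| ≤ Z) (hp : |p| ≤ M)
    (hp' : |p'| ≤ M) (hs : |s| ≤ M) (hmw : m ^ 2 + w ^ 2 ≤ M) (hbs : 1 ≤ b * s)
    (hL : L * b ^ 2 ≤ -2 * m * b + t * w ^ 2 - b ^ 2 * (p + p')) :
    L ≤ (1 + Z) * M ^ 3 + 1 + 2 * M := by
  have hb : b ≠ 0 := by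
    rintro rfl
    norm_num at hbs
  have hM : 0 ≤ M := (abs_nonneg p).trans hp
  have hbM : 1 ≤ b ^ 2 * M ^ 2 := calc
    1 ≤ (b * s) ^ 2 := one_le_pow₀ hbs
    _ = b ^ 2 * |s| ^ 2 := by rw [mul_pow, sq_abs]
    _ ≤ b ^ 2 * M ^ 2 := by gcongr
  have hrotation : t * w ^ 2 ≤ Z * w ^ 2 := by gcongr; exact (le_abs_self t).trans ht
  have hvelocity : m ^ 2 + Z * w ^ 2 ≤ (1 + Z) * M * (b ^ 2 * M ^ 2) := calc
    m ^ 2 + Z * w ^ 2 ≤ (1 + Z) * (m ^ 2 + w ^ 2) := by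
      nlinarith [sq_nonneg w, mul_nonneg hZ (sq_nonneg m)]
    _ ≤ (1 + Z) * M := by gcongr
    _ ≤ (1 + Z) * M * (b ^ 2 * M ^ 2) := le_mul_of_one_le_right (by positivity) hbM
  have hslopes : b ^ 2 * -(p + p') ≤ b ^ 2 * (2 * M) := by
    gcongr
    linarith [neg_abs_le p, neg_abs_le p']
  refine le_of_mul_le_mul_right ?_ (by positivity : 0 < b ^ 2)
  linarith [sq_nonneg (m + b)]

theorem HasEuclideanAssociatedEnergy.norm_gradient_le (h : HasEuclideanAssociatedEnergy x E)
    {μ : ℝ} (hμ : 0 < μ) {X : V} (hX : fderiv ℝ (fderiv ℝ E) y X = innerSL ℝ x)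
    (hle : μ * ‖X‖ ^ 2 ≤ fderiv ℝ (fderiv ℝ E) y X X) : ‖X‖ ≤ μ⁻¹ := by
  rcases eq_or_ne X 0 with rfl | hX0
  · simpa using hμ.le
  rw [hX, innerSL_apply_apply] at hle
  have hcs : μ * ‖X‖ * ‖X‖ ≤ 1 * ‖X‖ := calc
    μ * ‖X‖ * ‖X‖ = μ * ‖X‖ ^ 2 := by ring
    _ ≤ ‖x‖ * ‖X‖ := hle.trans (real_inner_le_norm x X)
    _ ≤ 1 * ‖X‖ := by gcongr; exact h.norm_axis_le_one
  rw [← one_div, le_div_iff₀' hμ]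
  exact le_of_mul_le_mul_right hcs (norm_pos_iff.2 hX0)

theorem HasEuclideanAssociatedEnergy.exists_uniform_bound [FiniteDimensional ℝ V]
    (h : HasEuclideanAssociatedEnergy x E) (Z : ℝ) :
    ∃ M : ℝ, 0 < M ∧ ∀ a ∈ equator x, ∀ t, |t| ≤ Z →
      |logSlope E x (a + t • x)| ≤ M ∧ |fderiv ℝ E (a + t • x) a| ≤ M ∧
      ∀ X, fderiv ℝ (fderiv ℝ E) (a + t • x) X = innerSL ℝ x → ‖X‖ ^ 2 ≤ M := by
  set K := (fun q : V × ℝ => q.1 + q.2 • x) '' (equator x ×ˢ Set.Icc (-Z) Z)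
  have hKc : IsCompact K := ((isCompact_equator x).prod isCompact_Icc).image (by fun_prop)
  have hK0 : K ⊆ {0}ᶜ := by
    rintro _ ⟨⟨a, t⟩, ⟨ha, -⟩, rfl⟩
    exact add_smul_ne_zero ha t
  have hderiv : ContinuousOn (fderiv ℝ E) K := h.continuousOn_fderiv.mono hK0
  have hslope : ContinuousOn (logSlope E x) K :=
    (hderiv.clm_apply continuousOn_const).div (h.continuousOn.mono hK0)
      fun y hy => (h.pos (hK0 hy)).ne'
  obtain ⟨M₁, hM₁⟩ := hKc.exists_bound_of_continuousOn hslope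
  obtain ⟨M₂, hM₂⟩ := hKc.exists_bound_of_continuousOn hderiv
  obtain ⟨μ, hμ, hle⟩ := h.exists_forall_mul_norm_sq_le_hess hKc hK0
  refine ⟨max (max M₁ M₂) (μ⁻¹ ^ 2), lt_max_of_lt_right (by positivity), fun a ha t ht => ?_⟩
  have hy : a + t • x ∈ K := ⟨(a, t), ⟨ha, abs_le.1 ht⟩, rfl⟩
  refine ⟨le_max_of_le_left (le_max_of_le_left (hM₁ _ hy)),
    le_max_of_le_left (le_max_of_le_right ?_), fun X hX => le_max_of_le_right ?_⟩
  · calc ‖fderiv ℝ E (a + t • x) a‖ ≤ ‖fderiv ℝ E (a + t • x)‖ * ‖a‖ :=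
          ContinuousLinearMap.le_opNorm _ a
      _ ≤ M₂ := by rw [ha.2, mul_one]; exact hM₂ _ hy
  · gcongr
    exact h.norm_gradient_le hμ hX (hle _ hy X)

theorem HasEuclideanAssociatedEnergy.exists_forall_log_sub_log_lt
    (h : HasEuclideanAssociatedEnergy x E) (hx : x ≠ 0) {d : ℝ} (hd : 0 < d) :
    ∃ Z : ℝ, ∀ t, Z ≤ |t| → ∀ a ∈ equator x, ∀ a' ∈ equator x,
      Real.log (E (a + t • x)) - Real.log (E (a' + t • x)) < d := by
  obtain ⟨Z, hZ⟩ := eventually_atTop.1 ((h.eventually_log_sub_log_lt hx hd).and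
    (h.eventually_log_sub_log_lt (neg_ne_zero.2 hx) hd))
  refine ⟨Z, fun t ht a ha a' ha' => ?_⟩
  rcases abs_cases t with ⟨habs, -⟩ | ⟨habs, -⟩
  · exact (hZ t (habs ▸ ht)).1 a a' ha.2 ha'.2
  · simpa using (hZ (-t) (habs ▸ ht)).2 a a' ha.2 ha'.2

theorem HasEuclideanAssociatedEnergy.continuousOn_barrier (h : HasEuclideanAssociatedEnergy x E)
    (e L : ℝ) : ContinuousOn (barrier E x e L) (equator x ×ˢ equator x ×ˢ Set.univ) := by
  refine ContinuousOn.add (ContinuousOn.sub ?_ ?_) (by fun_prop)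
  · exact h.continuousOn_log.comp (f := fun q : V × V × ℝ => q.1 + q.2.2 • x) (by fun_prop)
      fun q hq => add_smul_ne_zero hq.1 _
  · exact h.continuousOn_log.comp (f := fun q : V × V × ℝ => q.2.1 + q.2.2 • x) (by fun_prop)
      fun q hq => add_smul_ne_zero hq.2.1 _

theorem mul_exp_neg_mul_exp_le {c s Z : ℝ} (hL : 0 ≤ L) (hc : 0 ≤ c) (hs : |s| ≤ Z) :
    c * Real.exp (-(L * Z)) * Real.exp (L * s) ≤ c := by
  rw [mul_assoc, ← Real.exp_add]
  refine mul_le_of_le_one_right hc (Real.exp_le_one_iff.2 ?_)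
  linarith [mul_le_mul_of_nonneg_left ((le_abs_self s).trans hs) hL]

theorem HasEuclideanAssociatedEnergy.exists_isLocalMaxOn_barrier [FiniteDimensional ℝ V]
    (h : HasEuclideanAssociatedEnergy x E) (ha : a ∈ equator x) (ha' : a' ∈ equator x)
    (hlt : Real.log (E (a' + t • x)) < Real.log (E (a + t • x))) :
    ∃ Z : ℝ, 0 ≤ Z ∧ ∀ L > 0, ∃ e > 0, ∃ c ∈ equator x, ∃ c' ∈ equator x, ∃ s : ℝ, |s| ≤ Z ∧
      IsLocalMaxOn (barrier E x e L) (equator x ×ˢ equator x ×ˢ Set.univ) (c, c', s) := by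
  set d := Real.log (E (a + t • x)) - Real.log (E (a' + t • x))
  have hdpos : 0 < d := sub_pos.2 hlt
  obtain ⟨Z₀, hZ₀⟩ := h.exists_forall_log_sub_log_lt (h.axis_ne_zero (add_smul_ne_zero ha t))
    (half_pos hdpos)
  set Z := max Z₀ |t|
  refine ⟨Z, le_max_of_le_right (abs_nonneg t), fun L hL => ?_⟩
  set e := d / 2 * Real.exp (-(L * Z))
  have he : 0 < e := by positivity
  have hcompact : IsCompact (equator x ×ˢ equator x ×ˢ Set.Icc (-Z) Z) :=
    (isCompact_equator x).prod ((isCompact_equator x).prod isCompact_Icc)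
  obtain ⟨⟨c, c', s⟩, ⟨hc, hc', hs⟩, hmax⟩ := hcompact.exists_isMaxOn
    ⟨(a, a', t), ha, ha', abs_le.1 (le_max_right _ _)⟩
    ((h.continuousOn_barrier e L).mono fun q hq => ⟨hq.1, hq.2.1, Set.mem_univ _⟩)
  have hinterior : |s| < Z := by
    refine lt_of_le_of_ne (abs_le.2 hs) fun hboundary => ?_
    have hge : barrier E x e L (a, a', t) ≤ barrier E x e L (c, c', s) :=
      hmax ⟨ha, ha', abs_le.1 (le_max_right _ _)⟩
    have hfar := hZ₀ s (hboundary ▸ le_max_left _ _) c hc c' hc'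
    have hpos : 0 < e * Real.exp (L * t) := by positivity
    have hsmall : e * Real.exp (L * s) ≤ d / 2 :=
      mul_exp_neg_mul_exp_le hL.le (half_pos hdpos).le hboundary.le
    simp only [barrier] at hge
    linarith
  refine ⟨e, he, c, hc, c', hc', s, hinterior.le, ?_⟩
  have hnear : ∀ᶠ q : V × V × ℝ in 𝓝 (c, c', s), |q.2.2| < Z :=
    (by fun_prop : Continuous fun q : V × V × ℝ => |q.2.2|).tendsto (c, c', s) |>.eventually
      (gt_mem_nhds hinterior)
  filter_upwards [self_mem_nhdsWithin, nhdsWithin_le_nhds hnear] with q hq hqZ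
  exact hmax ⟨hq.1, hq.2.1, abs_le.1 hqZ.le⟩

theorem HasEuclideanAssociatedEnergy.log_le_log [FiniteDimensional ℝ V]
    (h : HasEuclideanAssociatedEnergy x E) (hdim : 3 ≤ Module.finrank ℝ V) (ha : a ∈ equator x)
    (ha' : a' ∈ equator x) (t : ℝ) :
    Real.log (E (a + t • x)) ≤ Real.log (E (a' + t • x)) := by
  by_contra! hlt
  obtain ⟨Z, hZ, hbarrier⟩ := h.exists_isLocalMaxOn_barrier ha ha' hlt
  obtain ⟨M, hM, hbound⟩ := h.exists_uniform_bound Z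
  obtain ⟨e, he, c, hc, c', hc', s, hs, hmax⟩ :=
    hbarrier ((1 + Z) * M ^ 3 + 1 + 2 * M + 1) (by positivity)
  obtain ⟨X, hX, m, w, b, hmw, hslope, hexp⟩ :=
    h.exists_exponent_mul_sq_le hdim hmax hc hc' he (by positivity)
  obtain ⟨hp, -, -⟩ := hbound c hc s hs
  obtain ⟨hp', hd', hX'⟩ := hbound c' hc' s hs
  linarith [exponent_le hZ hs hp hp' hd' (hmw.trans (hX' X hX)) hslope hexp]

theorem HasEuclideanAssociatedEnergy.apply_add_smul_eq [FiniteDimensional ℝ V]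
    (h : HasEuclideanAssociatedEnergy x E) (hdim : 3 ≤ Module.finrank ℝ V) (ha : a ∈ equator x)
    (ha' : a' ∈ equator x) (t : ℝ) : E (a + t • x) = E (a' + t • x) :=
  Real.log_injOn_pos (h.pos (add_smul_ne_zero ha t)) (h.pos (add_smul_ne_zero ha' t))
    (le_antisymm (h.log_le_log hdim ha ha' t) (h.log_le_log hdim ha' ha t))

theorem HasEuclideanAssociatedEnergy.exists_logSlope_eq_div_norm [FiniteDimensional ℝ V]
    (h : HasEuclideanAssociatedEnergy x E) (hdim : 3 ≤ Module.finrank ℝ V) :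
    ∃ K : ℝ, ∀ v, v ≠ 0 → ⟪x, v⟫ = 0 → logSlope E x v = K / ‖v‖ := by
  obtain ⟨a₀, ha₀, -⟩ := exists_mem_equator_inner_eq_zero hdim x 0
  have hconst : ∀ a ∈ equator x, logSlope E x a = logSlope E x a₀ := by
    intro a ha
    have hne : a ≠ 0 := by simpa using add_smul_ne_zero ha 0
    have hne₀ : a₀ ≠ 0 := by simpa using add_smul_ne_zero ha₀ 0
    have hline := h.apply_add_smul_eq hdim ha ha₀
    have hE : E a = E a₀ := by simpa using hline 0
    have hderiv := h.hasDerivAt_add_smul hne x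
    rw [funext hline] at hderiv
    rw [logSlope, logSlope, hE, hderiv.unique (h.hasDerivAt_add_smul hne₀ x)]
  refine ⟨logSlope E x a₀, fun v hv hxv => ?_⟩
  have hpos : 0 < ‖v‖ := norm_pos_iff.2 hv
  have hscale : v = ‖v‖ • ‖v‖⁻¹ • v := by rw [smul_smul, mul_inv_cancel₀ hpos.ne', one_smul]
  rw [← hconst _ (inv_norm_smul_mem_equator hv hxv), logSlope, logSlope]
  nth_rw 1 2 [hscale]
  rw [h.homogeneous.fderiv hpos, h.homogeneous hpos]
  simp only [pow_one, _root_.smul_apply, smul_eq_mul]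
  field_simp

end Rigidity

section LinearEquiv

open scoped RealInnerProductSpace

variable {V W : Type*} [NormedAddCommGroup V] [NormedSpace ℝ V] [NormedAddCommGroup W]
  [NormedSpace ℝ W] {E : V → ℝ}

theorem exists_linearEquiv_inner_eq {U : Type*} [AddCommGroup U] [Module ℝ U]
    [FiniteDimensional ℝ U] {B : U →ₗ[ℝ] U →ₗ[ℝ] ℝ} (hsymm : ∀ v w, B v w = B w v)
    (hpos : ∀ ⦃v⦄, v ≠ 0 → 0 < B v v) :
    ∃ T : EuclideanSpace ℝ (Fin (Module.finrank ℝ U)) ≃ₗ[ℝ] U, ∀ v w, B (T v) (T w) = ⟪v, w⟫ := by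
  let core : InnerProductSpace.Core ℝ U :=
    { inner v w := B v w
      conj_inner_symm v w := hsymm w v
      re_inner_nonneg v := by
        rcases eq_or_ne v 0 with rfl | hv
        · simp
        · exact (hpos hv).le
      add_left u v w := by simp
      smul_left v w r := by simp
      definite v hv := by
        by_contra hne
        exact (hpos hne).ne' hv }
  let := core.toNormedAddCommGroup
  let := InnerProductSpace.ofCore core.toCore
  exact ⟨(stdOrthonormalBasis ℝ U).repr.symm.toLinearEquiv,
    (stdOrthonormalBasis ℝ U).repr.symm.inner_map_map⟩

theorem fderiv_fderiv_comp_continuousLinearEquiv (T : W ≃L[ℝ] V) {y : W}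
    (hE : DifferentiableAt ℝ (fderiv ℝ E) (T y)) (v w : W) :
    fderiv ℝ (fderiv ℝ (E ∘ T)) y v w = fderiv ℝ (fderiv ℝ E) (T y) (T v) (T w) := by
  have hfst : fderiv ℝ (E ∘ T) = fun z => (fderiv ℝ E (T z)).comp (T : W →L[ℝ] V) :=
    funext fun z => T.comp_right_fderiv
  have hsnd := (hE.hasFDerivAt.comp y T.hasFDerivAt).clm_comp
    (hasFDerivAt_const (T : W →L[ℝ] V) y)
  rw [hfst]
  exact (DFunLike.congr_fun (DFunLike.congr_fun hsnd.fderiv v) w).trans (by simp)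

namespace IsMinkowskiEnergy

theorem comp_continuousLinearEquiv (h : IsMinkowskiEnergy E) (T : W ≃L[ℝ] V) :
    IsMinkowskiEnergy (E ∘ T) where
  pos y hy := h.pos (T.map_ne_zero_iff.2 hy)
  homogeneous t ht y := by simpa using h.homogeneous ht (T y)
  contDiffAt y hy := (h.contDiffAt (T.map_ne_zero_iff.2 hy)).comp y T.contDiff.contDiffAt
  hess_pos y hy z hz := by
    have hy' := T.map_ne_zero_iff.2 hy
    rw [fderiv_fderiv_comp_continuousLinearEquiv T
      ((h.contDiffAt_fderiv hy').differentiableAt one_ne_zero)]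
    exact h.hess_pos hy' (T.map_ne_zero_iff.2 hz)

theorem exists_logSlope_eq_div_sqrt [FiniteDimensional ℝ V] (h : IsMinkowskiEnergy E)
    (hdim : 3 ≤ Module.finrank ℝ V) {B : V →L[ℝ] V →L[ℝ] ℝ} (hsymm : ∀ v w, B v w = B w v)
    (hpos : ∀ ⦃v⦄, v ≠ 0 → 0 < B v v) {x : V}
    (hgrad : ∀ ⦃y⦄, y ≠ 0 →
      ∃ X, fderiv ℝ (fderiv ℝ E) y X = B x ∧ E y * B x X = B y y / 2) :
    ∃ K : ℝ, ∀ v, v ≠ 0 → B x v = 0 → logSlope E x v = K / √(B v v) := by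
  obtain ⟨T₀, hT₀⟩ := exists_linearEquiv_inner_eq (B := B.toBilinForm) hsymm hpos
  let T := T₀.toContinuousLinearEquiv
  have hT : ∀ v w, B (T v) (T w) = ⟪v, w⟫ := hT₀
  have hassoc : HasEuclideanAssociatedEnergy (T.symm x) (E ∘ T) := by
    refine ⟨h.comp_continuousLinearEquiv T, fun y hy => ?_⟩
    have hy' : T y ≠ 0 := T.map_ne_zero_iff.2 hy
    obtain ⟨X, hX, hEX⟩ := hgrad hy'
    refine ⟨T.symm X, ?_, ?_⟩
    · ext w
      rw [fderiv_fderiv_comp_continuousLinearEquiv T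
        ((h.contDiffAt_fderiv hy').differentiableAt one_ne_zero), T.apply_symm_apply, hX,
        innerSL_apply_apply, ← hT, T.apply_symm_apply]
    · rw [← hT, T.apply_symm_apply, T.apply_symm_apply, ← real_inner_self_eq_norm_sq, ← hT]
      exact hEX
  obtain ⟨K, hK⟩ := hassoc.exists_logSlope_eq_div_norm (by simpa using hdim)
  refine ⟨K, fun v hv hxv => ?_⟩
  have hslope := hK (T.symm v) (T.symm.map_ne_zero_iff.2 hv) (by simpa [← hT] using hxv)
  rw [@norm_eq_sqrt_real_inner, ← hT, T.apply_symm_apply] at hslope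
  simpa [logSlope, T.comp_right_fderiv] using hslope

end IsMinkowskiEnergy

end LinearEquiv

section PartialDerivative

open Filter Topology
open scoped Matrix

variable {m : ℕ} {f g : EuclideanSpace ℝ (Fin m) → ℝ} {y : EuclideanSpace ℝ (Fin m)}

theorem clm_apply_eq_dotProduct (A : EuclideanSpace ℝ (Fin m) →L[ℝ] ℝ)
    (v : EuclideanSpace ℝ (Fin m)) :
    A v = v.ofLp ⬝ᵥ fun i => A (EuclideanSpace.single i 1) := by
  conv_lhs => rw [← (EuclideanSpace.basisFun (Fin m) ℝ).sum_repr v]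
  simp [dotProduct]

theorem pd_congr (i : Fin m) (h : f =ᶠ[𝓝 y] g) : pd i f =ᶠ[𝓝 y] pd i g := by
  filter_upwards [h.fderiv (𝕜 := ℝ)] with z hz
  rw [pd, hz, pd]

theorem contDiffAt_pd {j k : WithTop ℕ∞} (i : Fin m) (hf : ContDiffAt ℝ k f y) (hj : j + 1 ≤ k) :
    ContDiffAt ℝ j (pd i f) y :=
  (hf.fderiv_right hj).clm_apply contDiffAt_const

theorem pd_add (i : Fin m) (hf : ContDiffAt ℝ 1 f y) (hg : ContDiffAt ℝ 1 g y) :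
    pd i (fun z => f z + g z) =ᶠ[𝓝 y] fun z => pd i f z + pd i g z := by
  filter_upwards [hf.eventually (by simp), hg.eventually (by simp)] with z hfz hgz
  simp [pd, fderiv_fun_add (hfz.differentiableAt one_ne_zero) (hgz.differentiableAt one_ne_zero)]

theorem pd_const_mul (i : Fin m) (c : ℝ) : pd i (fun z => c * f z) = fun z => c * pd i f z :=
  funext fun z => DFunLike.congr_fun (congrFun (fderiv_const_smul_field (f := f) c) z)
    (EuclideanSpace.single i 1)

theorem pd_exp_mul (i : Fin m) (hf : DifferentiableAt ℝ f y) (hg : DifferentiableAt ℝ g y) :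
    pd i (fun z => Real.exp (2 * f z) * g z) y =
      Real.exp (2 * f y) * (2 * pd i f y * g y + pd i g y) := by
  have hmul : HasFDerivAt (fun z => Real.exp (2 * f z) * g z) _ y :=
    (hf.hasFDerivAt.const_mul 2).exp.mul hg.hasFDerivAt
  rw [pd, hmul.fderiv]
  simp [pd]
  ring

/-- The third partial derivative `∂³f/∂y^i∂y^j∂y^k`, taken in the order in which it enters the
mixed curvature. -/
def thirdPartial (i j k : Fin m) (f : EuclideanSpace ℝ (Fin m) → ℝ) :
    EuclideanSpace ℝ (Fin m) → ℝ :=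
  pd k (pd j (pd i f))

theorem thirdPartial_congr (i j k : Fin m) (h : f =ᶠ[𝓝 y] g) :
    thirdPartial i j k f y = thirdPartial i j k g y :=
  (pd_congr k (pd_congr j (pd_congr i h))).self_of_nhds

theorem thirdPartial_add (i j k : Fin m) (hf : ContDiffAt ℝ 3 f y) (hg : ContDiffAt ℝ 3 g y) :
    thirdPartial i j k (fun z => f z + g z) y =
      thirdPartial i j k f y + thirdPartial i j k g y := by
  have hf₁ : ContDiffAt ℝ 2 (pd i f) y := contDiffAt_pd i hf (by norm_num)
  have hg₁ : ContDiffAt ℝ 2 (pd i g) y := contDiffAt_pd i hg (by norm_num)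
  have hfst := pd_add i (hf.of_le (by norm_num)) (hg.of_le (by norm_num))
  have hsnd := pd_add j (hf₁.of_le (by norm_num)) (hg₁.of_le (by norm_num))
  have hthird := pd_add k (contDiffAt_pd j hf₁ (by norm_num)) (contDiffAt_pd j hg₁ (by norm_num))
  exact ((pd_congr k (pd_congr j hfst)).trans ((pd_congr k hsnd).trans hthird)).self_of_nhds

theorem thirdPartial_const_mul (i j k : Fin m) (c : ℝ) :
    thirdPartial i j k (fun z => c * f z) = fun z => c * thirdPartial i j k f z := by
  simp only [thirdPartial, pd_const_mul]

theorem thirdPartial_sum {ι : Type*} (s : Finset ι) (i j k : Fin m)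
    {f : ι → EuclideanSpace ℝ (Fin m) → ℝ} (hf : ∀ l ∈ s, ContDiffAt ℝ 3 (f l) y) :
    thirdPartial i j k (fun z => ∑ l ∈ s, f l z) y = ∑ l ∈ s, thirdPartial i j k (f l) y := by
  classical
  induction s using Finset.induction_on with
  | empty => simpa using congrFun (thirdPartial_const_mul (f := fun _ => 0) i j k 0) y
  | insert l s hl ih =>
    rw [Finset.forall_mem_insert] at hf
    simp only [Finset.sum_insert hl]
    rw [thirdPartial_add i j k hf.1 (ContDiffAt.sum hf.2), ih hf.2]

theorem thirdPartial_clm_sq (i j k : Fin m) (A : EuclideanSpace ℝ (Fin m) →L[ℝ] ℝ) :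
    thirdPartial i j k (fun z => A z ^ 2) = 0 := by
  have hfst : pd i (fun z => A z ^ 2) = fun z => 2 * A (EuclideanSpace.single i 1) * A z := by
    funext z
    rw [pd, (A.hasFDerivAt.pow 2).fderiv]
    simp
    ring
  have hsnd : pd j A = fun _ => A (EuclideanSpace.single j 1) :=
    funext fun z => by rw [pd, A.fderiv]
  rw [thirdPartial, hfst, pd_const_mul, hsnd]
  ext z
  simp [pd]

end PartialDerivative

section Hessian

open scoped Matrix

variable {m : ℕ} {f : EuclideanSpace ℝ (Fin m) → ℝ} {y : EuclideanSpace ℝ (Fin m)}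

theorem hessian_apply (hf : ContDiffAt ℝ 2 f y) (i j : Fin m) :
    hessian f y i j = fderiv ℝ (fderiv ℝ f) y (EuclideanSpace.single j 1)
      (EuclideanSpace.single i 1) := by
  have hd : DifferentiableAt ℝ (fderiv ℝ f) y :=
    (hf.fderiv_right (m := 1) le_rfl).differentiableAt one_ne_zero
  change fderiv ℝ (fun z => fderiv ℝ f z (EuclideanSpace.single i 1)) y _ = _
  rw [(hd.hasFDerivAt.clm_apply (hasFDerivAt_const _ y)).fderiv]
  simp

theorem hess_apply_eq_dotProduct (hf : ContDiffAt ℝ 2 f y) (v w : EuclideanSpace ℝ (Fin m)) :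
    fderiv ℝ (fderiv ℝ f) y v w = w.ofLp ⬝ᵥ hessian f y *ᵥ v.ofLp := by
  rw [clm_apply_eq_dotProduct]
  congr 1
  funext i
  rw [← ContinuousLinearMap.flip_apply, clm_apply_eq_dotProduct, dotProduct_comm]
  simp only [ContinuousLinearMap.flip_apply, Matrix.mulVec, hessian_apply hf]

theorem hessian_mulVec (hf : ContDiffAt ℝ 2 f y) (v : EuclideanSpace ℝ (Fin m)) :
    hessian f y *ᵥ v.ofLp = fun i => fderiv ℝ (fderiv ℝ f) y v (EuclideanSpace.single i 1) := by
  ext i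
  simp [hess_apply_eq_dotProduct hf]

theorem posDef_hessian_iff (hf : ContDiffAt ℝ 2 f y) :
    (hessian f y).PosDef ↔ ∀ ⦃v⦄, v ≠ 0 → 0 < fderiv ℝ (fderiv ℝ f) y v v := by
  have hsymm : (hessian f y).IsHermitian := by
    ext i j
    simp [hessian_apply hf, (hf.isSymmSndFDerivAt (by simp)).eq]
  simp only [Matrix.posDef_iff_dotProduct_mulVec, hsymm, true_and, star_trivial,
    hess_apply_eq_dotProduct hf]
  exact ⟨fun h v hv => h (by simpa using hv),
    fun h x hx => @h (WithLp.toLp 2 x) (by simpa using hx)⟩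

theorem hess_inv_mulVec (hf : ContDiffAt ℝ 2 f y) (hdet : IsUnit (hessian f y).det)
    (A : EuclideanSpace ℝ (Fin m) →L[ℝ] ℝ) :
    fderiv ℝ (fderiv ℝ f) y
      (WithLp.toLp 2 ((hessian f y)⁻¹ *ᵥ fun i => A (EuclideanSpace.single i 1))) = A := by
  ext w
  rw [hess_apply_eq_dotProduct hf, Matrix.mulVec_mulVec, Matrix.mul_nonsing_inv _ hdet,
    Matrix.one_mulVec, ← clm_apply_eq_dotProduct]

theorem contDiffAt_hessian {j k : WithTop ℕ∞} (hf : ContDiffAt ℝ k f y) (hj : j + 1 + 1 ≤ k)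
    (a b : Fin m) : ContDiffAt ℝ j (fun z => hessian f z a b) y :=
  contDiffAt_pd b (contDiffAt_pd a hf hj) le_rfl

end Hessian

section MatrixInverse

variable {V : Type*} [NormedAddCommGroup V] [NormedSpace ℝ V] {ι : Type*} [Fintype ι]
  [DecidableEq ι] {k : WithTop ℕ∞} {y : V} {A : V → Matrix ι ι ℝ}

theorem contDiffAt_det (hA : ∀ i j, ContDiffAt ℝ k (fun z => A z i j) y) :
    ContDiffAt ℝ k (fun z => (A z).det) y := by
  simp only [Matrix.det_apply']
  exact ContDiffAt.sum fun σ _ => contDiffAt_const.mul (contDiffAt_prod fun i _ => hA _ _)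

theorem contDiffAt_inv_apply (hA : ∀ i j, ContDiffAt ℝ k (fun z => A z i j) y)
    (hdet : IsUnit (A y).det) (i j : ι) : ContDiffAt ℝ k (fun z => (A z)⁻¹ i j) y := by
  simp only [Matrix.inv_def, Ring.inverse_eq_inv', Matrix.smul_apply, smul_eq_mul,
    Matrix.adjugate_apply]
  refine ((contDiffAt_det hA).inv hdet.ne_zero).mul (contDiffAt_det fun a b => ?_)
  simp only [Matrix.updateRow_apply]
  split_ifs
  · exact contDiffAt_const
  · exact hA a b

end MatrixInverse

section ParametricPartial

open Filter Topology

variable {m : ℕ} {V : Type*} [NormedAddCommGroup V] [NormedSpace ℝ V]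
  {G : EuclideanSpace ℝ (Fin m) → V → ℝ} {x : EuclideanSpace ℝ (Fin m)} {y : V}

theorem differentiableAt_left (hG : DifferentiableAt ℝ (fun z : _ × V => G z.1 z.2) (x, y)) :
    DifferentiableAt ℝ (fun x' => G x' y) x :=
  DifferentiableAt.comp (g := fun z : _ × V => G z.1 z.2) (f := fun x' => (x', y)) x hG
    (by fun_prop)

theorem pd_left_eq (hG : DifferentiableAt ℝ (fun z : _ × V => G z.1 z.2) (x, y)) (k : Fin m) :
    pd k (fun x' => G x' y) x =
      fderiv ℝ (fun z : _ × V => G z.1 z.2) (x, y) (EuclideanSpace.single k 1, 0) := by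
  have hcomp := HasFDerivAt.comp (g := fun z : _ × V => G z.1 z.2) (f := fun x' => (x', y)) x
    hG.hasFDerivAt (hasFDerivAt_prodMk_left x y)
  exact (DFunLike.congr_fun hcomp.fderiv _).trans (by simp)

theorem contDiffAt_pd_left {j : WithTop ℕ∞}
    (hG : ContDiffAt ℝ (j + 1) (fun z : _ × V => G z.1 z.2) (x, y)) (k : Fin m) :
    ContDiffAt ℝ j (fun y' => pd k (fun x' => G x' y') x) y := by
  have hslice : ContDiffAt ℝ j (fun y' : V => (x, y')) y := by fun_prop
  have hfderiv : ContDiffAt ℝ j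
      (fun y' => fderiv ℝ (fun z : _ × V => G z.1 z.2) (x, y') (EuclideanSpace.single k 1, 0)) y :=
    (ContDiffAt.comp y (hG.fderiv_right le_rfl) hslice).clm_apply contDiffAt_const
  refine hfderiv.congr_of_eventuallyEq ?_
  have hG₁ : ContDiffAt ℝ 1 (fun z : _ × V => G z.1 z.2) (x, y) := hG.of_le le_add_self
  filter_upwards [hslice.continuousAt.eventually (hG₁.eventually (by simp))] with y' hy'
    using pd_left_eq (hy'.differentiableAt one_ne_zero) k

end ParametricPartial

section QuadraticForm

open Filter Topology
open scoped Matrix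

theorem fderiv_fderiv_quadratic {V : Type*} [NormedAddCommGroup V] [NormedSpace ℝ V] {q : V → ℝ}
    {B : V →L[ℝ] V →L[ℝ] ℝ} (hB : ∀ v w, B v w = B w v) (hq : ∀ w, q w = B w w / 2) (y : V) :
    fderiv ℝ (fderiv ℝ q) y = B := by
  have hfderiv : fderiv ℝ q = B := by
    ext y v
    have h : HasFDerivAt (fun w => B w w / 2) _ y :=
      (B.hasFDerivAt.clm_apply (hasFDerivAt_id y)).mul_const (2⁻¹ : ℝ)
    rw [funext hq, h.fderiv]
    simp [hB v y]
    ring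
  rw [hfderiv, B.fderiv]

variable {m : ℕ} {q : EuclideanSpace ℝ (Fin m) → ℝ}
  {W : Submodule ℝ (EuclideanSpace ℝ (Fin m))}

theorem isConnected_compl_of_finrank_add_two_le (hW : Module.finrank ℝ W + 2 ≤ m) :
    IsConnected (Wᶜ : Set (EuclideanSpace ℝ (Fin m))) := by
  apply isConnected_compl_of_one_lt_codim
  have hcodim := W.finrank_quotient_add_finrank
  rw [finrank_euclideanSpace_fin] at hcodim
  have hlt : 1 < Module.finrank ℝ (EuclideanSpace ℝ (Fin m) ⧸ W) := by omega
  rw [← Module.finrank_eq_rank]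
  exact_mod_cast hlt

theorem hessian_eq_of_thirdPartial_eq_zero {U : Set (EuclideanSpace ℝ (Fin m))} (hU : IsOpen U)
    (hconn : IsPreconnected U) (hsmooth : ∀ y ∈ U, ContDiffAt ℝ 3 q y)
    (hthird : ∀ y ∈ U, ∀ i j k, thirdPartial i j k q y = 0) {y z : EuclideanSpace ℝ (Fin m)}
    (hy : y ∈ U) (hz : z ∈ U) : hessian q y = hessian q z := by
  ext i j
  have hentry : ∀ y ∈ U, DifferentiableAt ℝ (fun z => hessian q z i j) y := fun y hy =>
    (contDiffAt_hessian (j := 1) (hsmooth y hy) (by norm_num) i j).differentiableAt one_ne_zero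
  have hzero : ∀ y ∈ U, fderiv ℝ (fun z => hessian q z i j) y = 0 := by
    intro y hy
    ext v
    rw [clm_apply_eq_dotProduct]
    exact Finset.sum_eq_zero fun k _ => mul_eq_zero_of_right _ (hthird y hy i j k)
  obtain ⟨c, hc⟩ := hU.exists_is_const_of_fderiv_eq_zero hconn
    (fun y hy => (hentry y hy).differentiableWithinAt) hzero
  rw [hc y hy, hc z hz]

theorem dense_compl_of_ne_top {V : Type*} [NormedAddCommGroup V] [NormedSpace ℝ V]
    {W : Submodule ℝ V} (hW : W ≠ ⊤) : Dense (Wᶜ : Set V) := by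
  rw [← interior_eq_empty_iff_dense_compl, ← Set.not_nonempty_iff_eq_empty]
  exact fun h => hW (W.eq_top_of_nonempty_interior' h)

theorem IsPosHomogeneous.eq_hess_apply_self_div_two {V : Type*} [NormedAddCommGroup V]
    [NormedSpace ℝ V] {q : V → ℝ} {y : V} (hq : IsPosHomogeneous 2 q) (hy : ContDiffAt ℝ 2 q y) :
    q y = fderiv ℝ (fderiv ℝ q) y y y / 2 := by
  have hfderiv : DifferentiableAt ℝ (fderiv ℝ q) y :=
    (hy.fderiv_right (m := 1) le_rfl).differentiableAt one_ne_zero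
  rw [hq.fderiv_fderiv_apply_self hfderiv, _root_.smul_apply,
    hq.fderiv_apply_self (hy.differentiableAt two_ne_zero)]
  simp

theorem IsPosHomogeneous.quadratic_of_thirdPartial_eq_zero (hq : IsPosHomogeneous 2 q)
    (hW : Module.finrank ℝ W + 2 ≤ m) (hzero : q 0 = 0) (hcont : ∀ y, y ≠ 0 → ContinuousAt q y)
    (hsmooth : ∀ y ∉ W, ContDiffAt ℝ 3 q y)
    (hthird : ∀ y ∉ W, ∀ i j k, thirdPartial i j k q y = 0) :
    ContDiff ℝ 2 q ∧ ∀ w, q w = fderiv ℝ (fderiv ℝ q) 0 w w / 2 := by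
  have hconn := isConnected_compl_of_finrank_add_two_le hW
  have hopen : IsOpen (Wᶜ : Set (EuclideanSpace ℝ (Fin m))) :=
    W.closed_of_finiteDimensional.isOpen_compl
  obtain ⟨e, he⟩ := hconn.nonempty
  have hsmooth₂ : ∀ y ∉ W, ContDiffAt ℝ 2 q y := fun y hy => (hsmooth y hy).of_le (by norm_num)
  set B := fderiv ℝ (fderiv ℝ q) e
  have hB : ∀ v w, B v w = B w v := (hsmooth₂ e he).isSymmSndFDerivAt (by simp)
  have hoff : ∀ y ∉ W, q y = B y y / 2 := by
    intro y hy
    have hhess : fderiv ℝ (fderiv ℝ q) y y y = B y y := by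
      rw [hess_apply_eq_dotProduct (hsmooth₂ y hy), hess_apply_eq_dotProduct (hsmooth₂ e he),
        hessian_eq_of_thirdPartial_eq_zero hopen hconn.isPreconnected hsmooth hthird hy he]
    rw [← hhess, hq.eq_hess_apply_self_div_two (hsmooth₂ y hy)]
  have hquad : ∀ w, q w = B w w / 2 := by
    intro w
    rcases eq_or_ne w 0 with rfl | hw
    · simp [hzero]
    have hdense := dense_compl_of_ne_top (W := W) (fun h => he (h ▸ Submodule.mem_top))
    have hcontB : ContinuousAt (fun w => B w w / 2) w := by fun_prop
    exact tendsto_nhds_unique_of_frequently_eq (hcont w hw) hcontB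
      ((mem_closure_iff_frequently.1 (hdense w)).mono hoff)
  refine ⟨?_, fun w => ?_⟩
  · rw [funext hquad]
    fun_prop
  · rw [fderiv_fderiv_quadratic hB hquad, hquad]

end QuadraticForm

section Differential

open scoped Matrix

variable {n : ℕ} {M : Type*} [TopologicalSpace M] [ChartedSpace (EuclideanSpace ℝ (Fin n)) M]
  {α : M → ℝ} {p : M}

theorem mfderiv_apply_eq_dotProduct (v : EuclideanSpace ℝ (Fin n)) :
    mfderiv (𝓡 n) 𝓘(ℝ, ℝ) α p v = v.ofLp ⬝ᵥ dα α p :=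
  clm_apply_eq_dotProduct (m := n) (mfderiv (𝓡 n) 𝓘(ℝ, ℝ) α p) v

theorem dα_ne_zero (hdα : mfderiv (𝓡 n) 𝓘(ℝ, ℝ) α p ≠ 0) : dα (n := n) α p ≠ 0 := by
  intro hzero
  refine hdα (ContinuousLinearMap.ext fun v => (mfderiv_apply_eq_dotProduct v).trans ?_)
  rw [hzero, dotProduct_zero]
  rfl

theorem differentiableAt_comp_extChartAt_symm (hα : MDifferentiableAt (𝓡 n) 𝓘(ℝ, ℝ) α p) :
    DifferentiableAt ℝ (fun x => α ((extChartAt (𝓡 n) p).symm x)) (extChartAt (𝓡 n) p p) :=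
  DifferentiableWithinAt.differentiableAt hα.differentiableWithinAt_writtenInExtChartAt (by simp)

theorem pd_comp_extChartAt_symm (hα : MDifferentiableAt (𝓡 n) 𝓘(ℝ, ℝ) α p) (k : Fin n) :
    pd k (fun x => α ((extChartAt (𝓡 n) p).symm x)) (extChartAt (𝓡 n) p p) = dα α p k := by
  have hmfderiv : (mfderiv (𝓡 n) 𝓘(ℝ, ℝ) α p : EuclideanSpace ℝ (Fin n) →L[ℝ] ℝ) =
      fderivWithin ℝ (fun x => α ((extChartAt (𝓡 n) p).symm x)) (Set.range (𝓡 n))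
        (extChartAt (𝓡 n) p p) := hα.mfderiv
  rw [(𝓡 n).range_eq_univ, fderivWithin_univ] at hmfderiv
  rw [pd, ← hmfderiv]
  rfl

end Differential

section Chart

variable {n : ℕ} {M : Type*} [TopologicalSpace M] [ChartedSpace (EuclideanSpace ℝ (Fin n)) M]
  [IsManifold (𝓡 n) ∞ M] {F : TangentBundle (𝓡 n) M → ℝ} {α : M → ℝ} {p : M}
  {y : EuclideanSpace ℝ (Fin n)}

theorem extChartAt_tangentBundle_self (p : M) (y : EuclideanSpace ℝ (Fin n)) :
    extChartAt (𝓡 n).tangent (⟨p, 0⟩ : TangentBundle (𝓡 n) M) ⟨p, y⟩ =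
      (extChartAt (𝓡 n) p p, y) :=
  Prod.ext rfl (tangentCoordChange_self (I := 𝓡 n) (mem_extChartAt_source p))

theorem mem_extChartAt_tangentBundle_source (p : M) (y : EuclideanSpace ℝ (Fin n)) :
    (⟨p, y⟩ : TangentBundle (𝓡 n) M) ∈
      (extChartAt (𝓡 n).tangent (⟨p, 0⟩ : TangentBundle (𝓡 n) M)).source := by
  simp

theorem extChartAt_tangentBundle_symm_self (p : M) (y : EuclideanSpace ℝ (Fin n)) :
    (extChartAt (𝓡 n).tangent (⟨p, 0⟩ : TangentBundle (𝓡 n) M)).symm (extChartAt (𝓡 n) p p, y) =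
      ⟨p, y⟩ := by
  rw [← extChartAt_tangentBundle_self]
  exact PartialEquiv.left_inv _ (mem_extChartAt_tangentBundle_source p y)

theorem localEnergy_self (F : TangentBundle (𝓡 n) M → ℝ) (p : M) :
    localEnergy F p (extChartAt (𝓡 n) p p) = energy F p := by
  funext y
  rw [localEnergy, extChartAt_tangentBundle_symm_self, energy]

theorem localEnergy_conformalChange (x y : EuclideanSpace ℝ (Fin n)) :
    localEnergy (conformalChange α F) p x y =
      Real.exp (2 * α ((extChartAt (𝓡 n) p).symm x)) * localEnergy F p x y := by
  set w := (extChartAt (𝓡 n).tangent (⟨p, 0⟩ : TangentBundle (𝓡 n) M)).symm (x, y) with hw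
  have hfst : w.1 = (extChartAt (𝓡 n) p).symm x := rfl
  rw [localEnergy, localEnergy, ← hw, conformalChange, hfst, two_mul, Real.exp_add]
  ring

theorem contDiffAt_localEnergy {k : ℕ∞} (hF : ContMDiffAt (𝓡 n).tangent 𝓘(ℝ, ℝ) k F ⟨p, y⟩) :
    ContDiffAt ℝ k (fun z : _ × _ => localEnergy F p z.1 z.2) (extChartAt (𝓡 n) p p, y) := by
  have : IsManifold (𝓡 n).tangent k (TangentBundle (𝓡 n) M) :=
    IsManifold.of_le (n := ∞) (by exact_mod_cast le_top)
  have hmem : (extChartAt (𝓡 n) p p, y) ∈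
      (extChartAt (𝓡 n).tangent (⟨p, 0⟩ : TangentBundle (𝓡 n) M)).target := by
    rw [← extChartAt_tangentBundle_self]
    exact PartialEquiv.map_source _ (mem_extChartAt_tangentBundle_source p y)
  have hchart := (contMDiffOn_extChartAt_symm (I := (𝓡 n).tangent) (n := k)
    (⟨p, 0⟩ : TangentBundle (𝓡 n) M)).contMDiffAt (extChartAt_target_mem_nhds' hmem)
  have hcomp : ContMDiffAt (𝓘(ℝ, EuclideanSpace ℝ (Fin n) × EuclideanSpace ℝ (Fin n))) 𝓘(ℝ, ℝ) k
      (F ∘ (extChartAt (𝓡 n).tangent (⟨p, 0⟩ : TangentBundle (𝓡 n) M)).symm)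
      (extChartAt (𝓡 n) p p, y) :=
    ContMDiffAt.comp _ (by rwa [extChartAt_tangentBundle_symm_self]) hchart
  exact contDiffAt_const.mul (hcomp.contDiffAt.pow 2)

theorem contDiffAt_energy {k : ℕ∞} (hF : ContMDiffAt (𝓡 n).tangent 𝓘(ℝ, ℝ) k F ⟨p, y⟩) :
    ContDiffAt ℝ k (energy F p) y := by
  rw [← localEnergy_self]
  exact ContDiffAt.comp y (f := fun y => (extChartAt (𝓡 n) p p, y)) (contDiffAt_localEnergy hF)
    (by fun_prop)

end Chart

section FinslerMetric

variable {n : ℕ} {M : Type*} [TopologicalSpace M] [ChartedSpace (EuclideanSpace ℝ (Fin n)) M]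
  [IsManifold (𝓡 n) ∞ M] {F : TangentBundle (𝓡 n) M → ℝ} {S : Set (TangentBundle (𝓡 n) M)}
  {α : M → ℝ} {p : M} {y : EuclideanSpace ℝ (Fin n)}

namespace IsFinslerMetric

theorem apply_zero (hF : IsFinslerMetric F S) (p : M) : F ⟨p, 0⟩ = 0 := by
  have htwo := hF.homogeneous p 0 2 two_pos
  rw [smul_zero] at htwo
  linarith

theorem isOpen_ne_zero (hF : IsFinslerMetric F S) :
    IsOpen {w : TangentBundle (𝓡 n) M | w.2 ≠ 0} := by
  have hpreimage : {w : TangentBundle (𝓡 n) M | w.2 ≠ 0} = F ⁻¹' {0}ᶜ := by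
    ext ⟨q, v⟩
    refine ⟨fun hv => (hF.pos q v hv).ne', fun hne hv => hne ?_⟩
    obtain rfl : v = 0 := hv
    exact hF.apply_zero q
  rw [hpreimage]
  exact isOpen_compl_singleton.preimage hF.continuous

theorem contMDiffAt_two (hF : IsFinslerMetric F S) (hy : y ≠ 0) :
    ContMDiffAt (𝓡 n).tangent 𝓘(ℝ, ℝ) 2 F ⟨p, y⟩ :=
  hF.contMDiffOn_two.contMDiffAt (hF.isOpen_ne_zero.mem_nhds hy)

theorem contMDiffAt_infty (hF : IsFinslerMetric F S) (hy : y ≠ 0)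
    (hyS : (⟨p, y⟩ : TangentBundle (𝓡 n) M) ∉ S) :
    ContMDiffAt (𝓡 n).tangent 𝓘(ℝ, ℝ) ∞ F ⟨p, y⟩ :=
  hF.smooth.contMDiffAt
    ((hF.isOpen_ne_zero.inter hF.isClosed_exceptional.isOpen_compl).mem_nhds ⟨hy, hyS⟩)

theorem isMinkowskiEnergy_energy (hF : IsFinslerMetric F S) (p : M) :
    IsMinkowskiEnergy (energy F p) where
  pos y hy := mul_pos one_half_pos (pow_pos (hF.pos p y hy) 2)
  homogeneous t ht y := by
    have hhom : F ⟨p, t • y⟩ = t * F ⟨p, y⟩ := hF.homogeneous p y t ht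
    rw [energy, energy, hhom, smul_eq_mul]
    ring
  contDiffAt y hy := contDiffAt_energy (hF.contMDiffAt_two hy)
  hess_pos y hy :=
    (posDef_hessian_iff (contDiffAt_energy (hF.contMDiffAt_two hy))).1 (hF.posDef p y hy)

theorem isUnit_det_metric (hF : IsFinslerMetric F S) (p : M) (hy : y ≠ 0) :
    IsUnit (metric F p y).det :=
  (hF.posDef p y hy).det_pos.ne'.isUnit

end IsFinslerMetric

end FinslerMetric

section Spray

open Filter Topology
open scoped Matrix

variable {n : ℕ} {M : Type*} [TopologicalSpace M] [ChartedSpace (EuclideanSpace ℝ (Fin n)) M]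
  [IsManifold (𝓡 n) ∞ M] {F : TangentBundle (𝓡 n) M → ℝ} {α : M → ℝ} {p : M}
  {y : EuclideanSpace ℝ (Fin n)}

/-- The covector `y^k ∂²E/∂y^m∂x^k - ∂E/∂x^m`, that is `2 g_{lm} G^l`, from which the metric
produces the spray coefficients. -/
def sprayForm (F : TangentBundle (𝓡 n) M → ℝ) (p : M) (x y : EuclideanSpace ℝ (Fin n))
    (m : Fin n) : ℝ :=
  (∑ k, y k * pd m (fun y' => pd k (fun x' => localEnergy F p x' y') x) y)
    - pd m (fun x' => localEnergy F p x' y) x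

theorem spray_eq_inv_hessian_mulVec (l : Fin n) (x y : EuclideanSpace ℝ (Fin n)) :
    spray F p l x y =
      (1 / 2) * ((hessian (localEnergy F p x) y)⁻¹ *ᵥ sprayForm F p x y) l :=
  rfl

theorem contDiffAt_spray {x : EuclideanSpace ℝ (Fin n)} {j : WithTop ℕ∞}
    (hE : ContDiffAt ℝ (j + 1 + 1) (fun z : _ × _ => localEnergy F p z.1 z.2) (x, y))
    (hdet : IsUnit (hessian (localEnergy F p x) y).det) (l : Fin n) :
    ContDiffAt ℝ j (spray F p l x) y := by
  have hslice : ContDiffAt ℝ (j + 1 + 1) (localEnergy F p x) y :=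
    ContDiffAt.comp y (f := fun y => (x, y)) hE (by fun_prop)
  have hpd := contDiffAt_pd_left (G := localEnergy F p) hE
  refine contDiffAt_const.mul (ContDiffAt.sum fun m _ => ContDiffAt.mul ?_ (ContDiffAt.sub ?_ ?_))
  · exact contDiffAt_inv_apply (contDiffAt_hessian hslice le_rfl) hdet l m
  · exact ContDiffAt.sum fun k _ => ContDiffAt.mul (by fun_prop) (contDiffAt_pd m (hpd k) le_rfl)
  · exact (hpd m).of_le le_self_add

theorem pd_localEnergy_conformalChange (hα : MDifferentiableAt (𝓡 n) 𝓘(ℝ, ℝ) α p)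
    (hE : DifferentiableAt ℝ (fun x => localEnergy F p x y) (extChartAt (𝓡 n) p p)) (k : Fin n) :
    pd k (fun x => localEnergy (conformalChange α F) p x y) (extChartAt (𝓡 n) p p) =
      Real.exp (2 * α p) * (2 * dα α p k * energy F p y +
        pd k (fun x => localEnergy F p x y) (extChartAt (𝓡 n) p p)) := by
  simp only [localEnergy_conformalChange]
  rw [pd_exp_mul k (differentiableAt_comp_extChartAt_symm hα) hE, pd_comp_extChartAt_symm hα,
    extChartAt_to_inv, localEnergy_self]

theorem pd_pd_localEnergy_conformalChange (hα : MDifferentiableAt (𝓡 n) 𝓘(ℝ, ℝ) α p)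
    (hE : ContDiffAt ℝ 2 (fun z : _ × _ => localEnergy F p z.1 z.2) (extChartAt (𝓡 n) p p, y))
    (m k : Fin n) :
    pd m (fun y' => pd k (fun x => localEnergy (conformalChange α F) p x y')
        (extChartAt (𝓡 n) p p)) y =
      Real.exp (2 * α p) * (2 * dα α p k * pd m (energy F p) y +
        pd m (fun y' => pd k (fun x => localEnergy F p x y') (extChartAt (𝓡 n) p p)) y) := by
  have hslice : ContDiffAt ℝ 2 (fun y' : EuclideanSpace ℝ (Fin n) =>
    (extChartAt (𝓡 n) p p, y')) y := by fun_prop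
  have henergy : ContDiffAt ℝ 2 (energy F p) y := by
    rw [← localEnergy_self]
    exact ContDiffAt.comp y (f := fun y' => (extChartAt (𝓡 n) p p, y')) hE hslice
  have hfst : (fun y' => pd k (fun x => localEnergy (conformalChange α F) p x y')
      (extChartAt (𝓡 n) p p)) =ᶠ[𝓝 y] fun y' => Real.exp (2 * α p) *
        (2 * dα α p k * energy F p y' +
          pd k (fun x => localEnergy F p x y') (extChartAt (𝓡 n) p p)) := by
    filter_upwards [hslice.continuousAt.eventually (hE.eventually (by simp))] with y' hy'
    exact pd_localEnergy_conformalChange hα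
      (differentiableAt_left (G := localEnergy F p) (hy'.differentiableAt two_ne_zero)) k
  rw [(pd_congr m hfst).self_of_nhds, pd_const_mul]
  dsimp only
  rw [(pd_add m (contDiffAt_const.mul (henergy.of_le one_le_two))
    (contDiffAt_pd_left (G := localEnergy F p) hE k)).self_of_nhds, pd_const_mul]

theorem sprayForm_conformalChange (hα : MDifferentiableAt (𝓡 n) 𝓘(ℝ, ℝ) α p)
    (hE : ContDiffAt ℝ 2 (fun z : _ × _ => localEnergy F p z.1 z.2) (extChartAt (𝓡 n) p p, y)) :
    sprayForm (conformalChange α F) p (extChartAt (𝓡 n) p p) y =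
      Real.exp (2 * α p) • (sprayForm F p (extChartAt (𝓡 n) p p) y +
        (2 * (y.ofLp ⬝ᵥ dα α p)) • (fun m => pd m (energy F p) y) -
        (2 * energy F p y) • dα α p) := by
  funext m
  have hdiff := differentiableAt_left (G := localEnergy F p) (hE.differentiableAt two_ne_zero)
  simp only [sprayForm, pd_localEnergy_conformalChange hα hdiff,
    pd_pd_localEnergy_conformalChange hα hE, dotProduct, Pi.smul_apply, Pi.add_apply,
    Pi.sub_apply, smul_eq_mul]
  have hsum : ∑ k, y k * (Real.exp (2 * α p) * (2 * dα α p k * pd m (energy F p) y +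
      pd m (fun y' => pd k (fun x => localEnergy F p x y') (extChartAt (𝓡 n) p p)) y)) =
      Real.exp (2 * α p) * (2 * (∑ k, y k * dα α p k) * pd m (energy F p) y +
        ∑ k, y k * pd m (fun y' => pd k (fun x => localEnergy F p x y')
          (extChartAt (𝓡 n) p p)) y) := by
    rw [Finset.mul_sum, Finset.sum_mul, ← Finset.sum_add_distrib, Finset.mul_sum]
    exact Finset.sum_congr rfl fun k _ => by ring
  rw [hsum]
  ring

theorem hessian_localEnergy_conformalChange (y : EuclideanSpace ℝ (Fin n)) :
    hessian (localEnergy (conformalChange α F) p (extChartAt (𝓡 n) p p)) y =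
      Real.exp (2 * α p) • metric F p y := by
  have henergy : localEnergy (conformalChange α F) p (extChartAt (𝓡 n) p p) =
      fun y' => Real.exp (2 * α p) * energy F p y' := by
    funext y'
    rw [localEnergy_conformalChange, extChartAt_to_inv, localEnergy_self]
  rw [henergy]
  ext i j
  simp [hessian, metric, pd_const_mul]

namespace IsFinslerMetric

variable {S : Set (TangentBundle (𝓡 n) M)}

theorem inv_metric_mulVec_pd_energy (hF : IsFinslerMetric F S) (hy : y ≠ 0) :
    (metric F p y)⁻¹ *ᵥ (fun m => pd m (energy F p) y) = y.ofLp := by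
  have heuler : metric F p y *ᵥ y.ofLp = fun m => pd m (energy F p) y := by
    rw [metric, hessian_mulVec (contDiffAt_energy (hF.contMDiffAt_two hy)),
      (hF.isMinkowskiEnergy_energy p).hess_apply_self hy]
    rfl
  rw [← heuler, Matrix.mulVec_mulVec, Matrix.nonsing_inv_mul _ (hF.isUnit_det_metric p hy),
    Matrix.one_mulVec]

theorem spray_conformalChange (hF : IsFinslerMetric F S)
    (hα : MDifferentiableAt (𝓡 n) 𝓘(ℝ, ℝ) α p) (hy : y ≠ 0) (l : Fin n) :
    spray (conformalChange α F) p l (extChartAt (𝓡 n) p p) y =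
      spray F p l (extChartAt (𝓡 n) p p) y +
        ((y.ofLp ⬝ᵥ dα α p) * y l - energy F p y * gradX F α p l y) := by
  have hE := contDiffAt_localEnergy (hF.contMDiffAt_two (p := p) hy)
  have hinv : (Real.exp (2 * α p) • metric F p y)⁻¹ =
      (Real.exp (2 * α p))⁻¹ • (metric F p y)⁻¹ :=
    Matrix.inv_smul' _ (Units.mk0 _ (Real.exp_ne_zero _)) (hF.isUnit_det_metric p hy)
  have hgradX : ((metric F p y)⁻¹ *ᵥ dα α p) l = gradX F α p l y := rfl
  rw [spray_eq_inv_hessian_mulVec, spray_eq_inv_hessian_mulVec, sprayForm_conformalChange hα hE,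
    hessian_localEnergy_conformalChange, hinv, localEnergy_self, Matrix.smul_mulVec,
    Matrix.mulVec_smul, inv_smul_smul₀ (Real.exp_ne_zero _), Matrix.mulVec_sub,
    Matrix.mulVec_add, Matrix.mulVec_smul, Matrix.mulVec_smul,
    hF.inv_metric_mulVec_pd_energy hy]
  simp only [Pi.sub_apply, Pi.add_apply, Pi.smul_apply, smul_eq_mul, hgradX]
  rw [metric]
  ring

theorem sum_spray_conformalChange_add_energyStar (hF : IsFinslerMetric F S)
    (hα : MDifferentiableAt (𝓡 n) 𝓘(ℝ, ℝ) α p) (hy : y ≠ 0) :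
    (∑ l, spray (conformalChange α F) p l (extChartAt (𝓡 n) p p) y * dα α p l) +
        energyStar F α p y =
      (∑ l, spray F p l (extChartAt (𝓡 n) p p) y * dα α p l) + (y.ofLp ⬝ᵥ dα α p) ^ 2 := by
  simp only [hF.spray_conformalChange hα hy, energyStar, add_mul, sub_mul,
    Finset.sum_add_distrib, Finset.sum_sub_distrib, mul_assoc, ← Finset.mul_sum, sq]
  rw [dotProduct]
  ring

end IsFinslerMetric

end Spray

section AssociatedMetric

open Filter Topology
open scoped Matrix

variable {n : ℕ} {M : Type*} [TopologicalSpace M] [ChartedSpace (EuclideanSpace ℝ (Fin n)) M]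
  [IsManifold (𝓡 n) ∞ M] {F : TangentBundle (𝓡 n) M → ℝ} {S : Set (TangentBundle (𝓡 n) M)}
  {α : M → ℝ} {p : M} {y : EuclideanSpace ℝ (Fin n)}

theorem sum_mixedCurvature_mul_dα
    (hspray : ∀ l, ContDiffAt ℝ 3 (spray F p l (extChartAt (𝓡 n) p p)) y) (i j k : Fin n) :
    ∑ l, mixedCurvature F p l i j k y * dα α p l =
      -thirdPartial i j k
        (fun z => ∑ l, spray F p l (extChartAt (𝓡 n) p p) z * dα α p l) y := by
  simp only [mul_comm _ (dα α p _)]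
  rw [thirdPartial_sum _ i j k fun l _ => contDiffAt_const.mul (hspray l),
    ← Finset.sum_neg_distrib]
  refine Finset.sum_congr rfl fun l _ => ?_
  rw [thirdPartial_const_mul, mixedCurvature, mul_neg, thirdPartial]

namespace IsFinslerMetric

theorem contDiffAt_gradX (hF : IsFinslerMetric F S) {j : WithTop ℕ∞} (hy : y ≠ 0)
    (hE : ContDiffAt ℝ (j + 1 + 1) (energy F p) y) (l : Fin n) :
    ContDiffAt ℝ j (gradX F α p l) y :=
  ContDiffAt.sum fun m _ => (contDiffAt_inv_apply (contDiffAt_hessian hE le_rfl)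
    (hF.isUnit_det_metric p hy) l m).mul contDiffAt_const

theorem contDiffAt_energyStar (hF : IsFinslerMetric F S) {j : WithTop ℕ∞} (hy : y ≠ 0)
    (hE : ContDiffAt ℝ (j + 1 + 1) (energy F p) y) : ContDiffAt ℝ j (energyStar F α p) y :=
  (hE.of_le (le_self_add.trans le_self_add)).mul
    (ContDiffAt.sum fun l _ => (hF.contDiffAt_gradX hy hE l).mul contDiffAt_const)

theorem contDiffAt_spray_conformalChange (hF : IsFinslerMetric F S)
    (hα : MDifferentiableAt (𝓡 n) 𝓘(ℝ, ℝ) α p) {j : WithTop ℕ∞} (hy : y ≠ 0)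
    (hE : ContDiffAt ℝ (j + 1 + 1) (energy F p) y) {l : Fin n}
    (hspray : ContDiffAt ℝ j (spray F p l (extChartAt (𝓡 n) p p)) y) :
    ContDiffAt ℝ j (spray (conformalChange α F) p l (extChartAt (𝓡 n) p p)) y := by
  have hlin : ContDiffAt ℝ j (fun z : EuclideanSpace ℝ (Fin n) => (z.ofLp ⬝ᵥ dα α p) * z l) y := by
    simp only [dotProduct]
    fun_prop
  have hEX : ContDiffAt ℝ j (fun z => energy F p z * gradX F α p l z) y :=
    (hE.of_le (le_self_add.trans le_self_add)).mul (hF.contDiffAt_gradX hy hE l)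
  refine (hspray.add (hlin.sub hEX)).congr_of_eventuallyEq ?_
  filter_upwards [isOpen_ne.mem_nhds hy] with z hz using hF.spray_conformalChange hα hz l

theorem thirdPartial_energyStar (hF : IsFinslerMetric F S)
    (hα : MDifferentiableAt (𝓡 n) 𝓘(ℝ, ℝ) α p) (hy : y ≠ 0)
    (hyS : (⟨p, y⟩ : TangentBundle (𝓡 n) M) ∉ S) (i j k : Fin n)
    (hinv : ∑ l, mixedCurvature (conformalChange α F) p l i j k y * dα α p l =
      ∑ l, mixedCurvature F p l i j k y * dα α p l) :
    thirdPartial i j k (energyStar F α p) y = 0 := by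
  set x₀ := extChartAt (𝓡 n) p p
  set A : EuclideanSpace ℝ (Fin n) →L[ℝ] ℝ := mfderiv (𝓡 n) 𝓘(ℝ, ℝ) α p
  have hE : ContDiffAt ℝ (3 + 1 + 1) (fun z : _ × _ => localEnergy F p z.1 z.2) (x₀, y) :=
    (contDiffAt_localEnergy (hF.contMDiffAt_infty hy hyS)).of_le
      (WithTop.coe_le_coe.2 (le_top : (3 + 1 + 1 : ℕ∞) ≤ ⊤))
  have henergy : ContDiffAt ℝ (3 + 1 + 1) (energy F p) y :=
    (contDiffAt_energy (hF.contMDiffAt_infty hy hyS)).of_le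
      (WithTop.coe_le_coe.2 (le_top : (3 + 1 + 1 : ℕ∞) ≤ ⊤))
  have hspray : ∀ l, ContDiffAt ℝ 3 (spray F p l x₀) y :=
    contDiffAt_spray hE (by rw [localEnergy_self]; exact hF.isUnit_det_metric p hy)
  have hspray' : ∀ l, ContDiffAt ℝ 3 (spray (conformalChange α F) p l x₀) y := fun l =>
    hF.contDiffAt_spray_conformalChange hα hy henergy (hspray l)
  have hcontracted : (fun z => (∑ l, spray (conformalChange α F) p l x₀ z * dα α p l) +
      energyStar F α p z) =ᶠ[𝓝 y] fun z => (∑ l, spray F p l x₀ z * dα α p l) + A z ^ 2 := by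
    filter_upwards [isOpen_ne.mem_nhds hy] with z hz
    rw [hF.sum_spray_conformalChange_add_energyStar hα hz, ← mfderiv_apply_eq_dotProduct]
    rfl
  have hthird := thirdPartial_congr i j k hcontracted
  rw [thirdPartial_add i j k (ContDiffAt.sum fun l _ => (hspray' l).mul contDiffAt_const)
      (hF.contDiffAt_energyStar hy henergy),
    thirdPartial_add i j k (ContDiffAt.sum fun l _ => (hspray l).mul contDiffAt_const)
      (A.contDiff.contDiffAt.pow 2), thirdPartial_clm_sq] at hthird
  rw [sum_mixedCurvature_mul_dα hspray', sum_mixedCurvature_mul_dα hspray] at hinv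
  rw [neg_inj.1 hinv] at hthird
  exact add_left_cancel hthird

end IsFinslerMetric

end AssociatedMetric

section AssociatedEnergy

open scoped Matrix

variable {n : ℕ} {M : Type*} [TopologicalSpace M] [ChartedSpace (EuclideanSpace ℝ (Fin n)) M]
  {F : TangentBundle (𝓡 n) M → ℝ} {S : Set (TangentBundle (𝓡 n) M)} {α : M → ℝ} {p : M}
  {y : EuclideanSpace ℝ (Fin n)}

theorem energyStar_eq_sum_metricStar (hsmooth : ContDiff ℝ 2 (energyStar F α p))
    (hquad : ∀ w, energyStar F α p w = fderiv ℝ (fderiv ℝ (energyStar F α p)) 0 w w / 2)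
    (w : EuclideanSpace ℝ (Fin n)) :
    energyStar F α p w = (1 / 2) * ∑ i, ∑ j, metricStar F α p i j * w i * w j := by
  rw [hquad, hess_apply_eq_dotProduct hsmooth.contDiffAt, one_div_mul_eq_div]
  simp only [dotProduct, Matrix.mulVec, Finset.mul_sum, metricStar]
  congr! 3
  ring

theorem hess_energyStar_gradStar (hsmooth : ContDiff ℝ 2 (energyStar F α p))
    (hpos : (metricStar F α p).PosDef) :
    fderiv ℝ (fderiv ℝ (energyStar F α p)) 0 (gradStar F α p) =
      (mfderiv (𝓡 n) 𝓘(ℝ, ℝ) α p : EuclideanSpace ℝ (Fin n) →L[ℝ] ℝ) :=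
  hess_inv_mulVec hsmooth.contDiffAt hpos.det_pos.ne'.isUnit _

theorem energyOnLine_zero : energyOnLine F α p y 0 = energy F p y := by
  rw [energyOnLine, zero_smul, add_zero]

variable [IsManifold (𝓡 n) ∞ M]

namespace IsFinslerMetric

theorem energyStar_zero (hF : IsFinslerMetric F S) (α : M → ℝ) (p : M) :
    energyStar F α p 0 = 0 := by
  have hzero : F ⟨p, (0 : EuclideanSpace ℝ (Fin n))⟩ = 0 := hF.apply_zero p
  simp [energyStar, energy, hzero]

theorem metric_smul (hF : IsFinslerMetric F S) (p : M) {t : ℝ} (ht : 0 < t) (hy : y ≠ 0) :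
    metric F p (t • y) = metric F p y := by
  ext i j
  rw [metric, metric, hessian_apply (contDiffAt_energy (hF.contMDiffAt_two hy)),
    hessian_apply (contDiffAt_energy (hF.contMDiffAt_two (smul_ne_zero ht.ne' hy))),
    (hF.isMinkowskiEnergy_energy p).hess_smul ht]

theorem isPosHomogeneous_energyStar (hF : IsFinslerMetric F S) (α : M → ℝ) (p : M) :
    IsPosHomogeneous 2 (energyStar F α p) := by
  intro t ht y
  rcases eq_or_ne y 0 with rfl | hy
  · rw [smul_zero, hF.energyStar_zero, smul_zero]
  simp only [energyStar, gradX, hF.metric_smul p ht hy,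
    (hF.isMinkowskiEnergy_energy p).homogeneous ht y, smul_eq_mul, mul_assoc]

theorem energyStar_pos (hF : IsFinslerMetric F S) (hdα : mfderiv (𝓡 n) 𝓘(ℝ, ℝ) α p ≠ 0)
    (hy : y ≠ 0) : 0 < energyStar F α p y := by
  have hnorm : 0 < dα α p ⬝ᵥ ((metric F p y)⁻¹ *ᵥ dα α p) :=
    (hF.posDef p y hy).inv.dotProduct_mulVec_pos (dα_ne_zero hdα)
  rw [dotProduct_comm] at hnorm
  exact mul_pos ((hF.isMinkowskiEnergy_energy p).pos hy) hnorm

theorem normStar_pos (hF : IsFinslerMetric F S) (hdα : mfderiv (𝓡 n) 𝓘(ℝ, ℝ) α p ≠ 0)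
    (hy : y ≠ 0) : 0 < normStar F α p y :=
  Real.sqrt_pos.2 (mul_pos two_pos (hF.energyStar_pos hdα hy))

theorem exists_hess_energy_eq_mfderiv (hF : IsFinslerMetric F S) (hy : y ≠ 0) :
    ∃ X : EuclideanSpace ℝ (Fin n),
      fderiv ℝ (fderiv ℝ (energy F p)) y X =
        (mfderiv (𝓡 n) 𝓘(ℝ, ℝ) α p : EuclideanSpace ℝ (Fin n) →L[ℝ] ℝ) ∧
      energy F p y * fderiv ℝ (fderiv ℝ (energy F p)) y X X = energyStar F α p y := by
  set X : EuclideanSpace ℝ (Fin n) := WithLp.toLp 2 fun l => gradX F α p l y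
  have hX : fderiv ℝ (fderiv ℝ (energy F p)) y X =
      (mfderiv (𝓡 n) 𝓘(ℝ, ℝ) α p : EuclideanSpace ℝ (Fin n) →L[ℝ] ℝ) :=
    hess_inv_mulVec (contDiffAt_energy (hF.contMDiffAt_two hy)) (hF.isUnit_det_metric p hy) _
  refine ⟨X, hX, ?_⟩
  rw [hX]
  exact congrArg (energy F p y * ·) (mfderiv_apply_eq_dotProduct X)

theorem hasDerivAt_energyOnLine (hF : IsFinslerMetric F S) (α : M → ℝ) (p : M) (hy : y ≠ 0) :
    HasDerivAt (energyOnLine F α p y) (fderiv ℝ (energy F p) y (gradStar F α p)) 0 :=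
  (hF.isMinkowskiEnergy_energy p).hasDerivAt_add_smul hy _

theorem energyOnLine_zero_pos (hF : IsFinslerMetric F S) (α : M → ℝ) (p : M) (hy : y ≠ 0) :
    0 < energyOnLine F α p y 0 := by
  rw [energyOnLine_zero]
  exact (hF.isMinkowskiEnergy_energy p).pos hy

theorem deriv_energyOnLine_div (hF : IsFinslerMetric F S) (α : M → ℝ) (p : M) (hy : y ≠ 0) :
    deriv (energyOnLine F α p y) 0 / energyOnLine F α p y 0 =
      logSlope (energy F p) (gradStar F α p) y := by
  rw [(hF.hasDerivAt_energyOnLine α p hy).deriv, energyOnLine_zero, logSlope]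

end IsFinslerMetric

end AssociatedEnergy

section InvariantMixedCurvature

variable {n : ℕ} {M : Type*} [TopologicalSpace M] [ChartedSpace (EuclideanSpace ℝ (Fin n)) M]
  [IsManifold (𝓡 n) ∞ M] {F : TangentBundle (𝓡 n) M → ℝ} {S : Set (TangentBundle (𝓡 n) M)}
  {α : M → ℝ} {p : M}

namespace IsFinslerMetric

theorem quadratic_energyStar (hF : IsFinslerMetric F S)
    (hα : MDifferentiableAt (𝓡 n) 𝓘(ℝ, ℝ) α p) {W : Submodule ℝ (EuclideanSpace ℝ (Fin n))}
    (hW : Module.finrank ℝ W + 2 ≤ n)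
    (hS : ∀ y, (⟨p, y⟩ : TangentBundle (𝓡 n) M) ∈ S → y ∈ W)
    (hinv : ∀ y, y ≠ 0 → (⟨p, y⟩ : TangentBundle (𝓡 n) M) ∉ S → ∀ i j k : Fin n,
      ∑ l, mixedCurvature (conformalChange α F) p l i j k y * dα α p l =
        ∑ l, mixedCurvature F p l i j k y * dα α p l) :
    ContDiff ℝ 2 (energyStar F α p) ∧
      ∀ w, energyStar F α p w = fderiv ℝ (fderiv ℝ (energyStar F α p)) 0 w w / 2 := by
  have hne : ∀ y ∉ W, y ≠ 0 := fun y hy h => hy (h ▸ W.zero_mem)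
  have hreg : ∀ y ∉ W, (⟨p, y⟩ : TangentBundle (𝓡 n) M) ∉ S := fun y hy h => hy (hS y h)
  refine (hF.isPosHomogeneous_energyStar α p).quadratic_of_thirdPartial_eq_zero hW
    (hF.energyStar_zero α p) (fun y hy => ?_) (fun y hy => ?_) fun y hy i j k =>
      hF.thirdPartial_energyStar hα (hne y hy) (hreg y hy) i j k
        (hinv y (hne y hy) (hreg y hy) i j k)
  · exact (hF.contDiffAt_energyStar (j := 0) hy
      ((contDiffAt_energy (hF.contMDiffAt_two hy)).of_le (by norm_num))).continuousAt
  · exact hF.contDiffAt_energyStar (hne y hy)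
      ((contDiffAt_energy (hF.contMDiffAt_infty (hne y hy) (hreg y hy))).of_le
        (WithTop.coe_le_coe.2 (le_top : (3 + 1 + 1 : ℕ∞) ≤ ⊤)))

theorem posDef_metricStar (hF : IsFinslerMetric F S)
    (hdα : mfderiv (𝓡 n) 𝓘(ℝ, ℝ) α p ≠ 0) (hsmooth : ContDiff ℝ 2 (energyStar F α p))
    (hquad : ∀ w, energyStar F α p w = fderiv ℝ (fderiv ℝ (energyStar F α p)) 0 w w / 2) :
    (metricStar F α p).PosDef := by
  refine (posDef_hessian_iff hsmooth.contDiffAt).2 fun v hv => ?_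
  have hpos := hF.energyStar_pos hdα hv
  rw [hquad] at hpos
  linarith

theorem exists_logSlope_energy_eq_div_normStar (hF : IsFinslerMetric F S) (hn : 3 ≤ n)
    (hdα : mfderiv (𝓡 n) 𝓘(ℝ, ℝ) α p ≠ 0) (hsmooth : ContDiff ℝ 2 (energyStar F α p))
    (hquad : ∀ w, energyStar F α p w = fderiv ℝ (fderiv ℝ (energyStar F α p)) 0 w w / 2) :
    ∃ K : ℝ, ∀ v : EuclideanSpace ℝ (Fin n), v ≠ 0 → mfderiv (𝓡 n) 𝓘(ℝ, ℝ) α p v = 0 →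
      logSlope (energy F p) (gradStar F α p) v = K / normStar F α p v := by
  set B := fderiv ℝ (fderiv ℝ (energyStar F α p)) 0
  have hpos := hF.posDef_metricStar hdα hsmooth hquad
  have hB := hess_energyStar_gradStar hsmooth hpos
  have hsymm : ∀ v w, B v w = B w v := hsmooth.contDiffAt.isSymmSndFDerivAt (by simp)
  obtain ⟨K, hK⟩ := (hF.isMinkowskiEnergy_energy p).exists_logSlope_eq_div_sqrt (by simpa using hn)
    hsymm ((posDef_hessian_iff hsmooth.contDiffAt).1 hpos) (x := gradStar F α p) fun y hy => by
      obtain ⟨X, hX, hEX⟩ := hF.exists_hess_energy_eq_mfderiv (α := α) hy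
      rw [← hX] at hB
      exact ⟨X, hB.symm, by rw [hB, hEX, hquad]⟩
  refine ⟨K, fun v hv hvα => (hK v hv ((DFunLike.congr_fun hB v).trans hvα)).trans ?_⟩
  rw [normStar, hquad, mul_div_cancel₀ _ two_ne_zero]

end IsFinslerMetric

end InvariantMixedCurvature

end ConformalFinsler

end

open ConformalFinsler in
theorem theorem4_general {n : ℕ} (hn : 3 ≤ n) {M : Type*} [TopologicalSpace M]
    [ChartedSpace (EuclideanSpace ℝ (Fin n)) M] [IsManifold (𝓡 n) ∞ M]
    (F : TangentBundle (𝓡 n) M → ℝ) (S : Set (TangentBundle (𝓡 n) M))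
    (hF : IsFinslerMetric F S)
    (α : M → ℝ) (p : M) (hdα : mfderiv (𝓡 n) 𝓘(ℝ, ℝ) α p ≠ 0)
    (W : Submodule ℝ (TangentSpace (𝓡 n) p)) (hW : Module.finrank ℝ W + 2 ≤ n)
    (hS : ∀ v : TangentSpace (𝓡 n) p, (⟨p, v⟩ : TangentBundle (𝓡 n) M) ∈ S → v ∈ W)
    (hinv : ∀ v : TangentSpace (𝓡 n) p, v ≠ 0 → (⟨p, v⟩ : TangentBundle (𝓡 n) M) ∉ S →
      ∀ i j k : Fin n,
        ∑ l, mixedCurvature (conformalChange α F) p l i j k v * dα α p l =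
          ∑ l, mixedCurvature F p l i j k v * dα α p l) :
    (metricStar F α p).PosDef ∧
    (∀ w : EuclideanSpace ℝ (Fin n),
      energyStar F α p w = (1 / 2) * ∑ i, ∑ j, metricStar F α p i j * w i * w j) ∧
    ∃ K : ℝ, ∀ v : TangentSpace (𝓡 n) p, v ≠ 0 → mfderiv (𝓡 n) 𝓘(ℝ, ℝ) α p v = 0 →
      0 < normStar F α p v ∧
      0 < energyOnLine F α p v 0 ∧
      DifferentiableAt ℝ (energyOnLine F α p v) 0 ∧
      deriv (energyOnLine F α p v) 0 / energyOnLine F α p v 0 = K / normStar F α p v := by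
  have hα : MDifferentiableAt (𝓡 n) 𝓘(ℝ, ℝ) α p := by
    by_contra hα
    exact hdα (mfderiv_zero_of_not_mdifferentiableAt hα)
  obtain ⟨hsmooth, hquad⟩ := hF.quadratic_energyStar hα hW hS hinv
  obtain ⟨K, hK⟩ := hF.exists_logSlope_energy_eq_div_normStar hn hdα hsmooth hquad
  refine ⟨hF.posDef_metricStar hdα hsmooth hquad, energyStar_eq_sum_metricStar hsmooth hquad,
    K, fun v hv hvα =>
    ⟨hF.normStar_pos hdα hv, hF.energyOnLine_zero_pos α p hv,
      (hF.hasDerivAt_energyOnLine α p hv).differentiableAt,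
      (hF.deriv_energyOnLine_div α p hv).trans (hK v hv hvα)⟩⟩

open ConformalFinsler in
theorem theorem4 {n : ℕ} (hn : 3 ≤ n) {M : Type*} [TopologicalSpace M]
    [ChartedSpace (EuclideanSpace ℝ (Fin n)) M] [IsManifold (𝓡 n) ∞ M]
    (F : TangentBundle (𝓡 n) M → ℝ) (S : Set (TangentBundle (𝓡 n) M))
    (hF : IsFinslerMetric F S)
    (α : M → ℝ) (hα : ContMDiff (𝓡 n) 𝓘(ℝ, ℝ) ∞ α)
    (p : M) (hdα : mfderiv (𝓡 n) 𝓘(ℝ, ℝ) α p ≠ 0)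
    (u : TangentSpace (𝓡 n) p)
    (hS : ∀ v : TangentSpace (𝓡 n) p, (⟨p, v⟩ : TangentBundle (𝓡 n) M) ∈ S →
      ∃ c : ℝ, v = c • u)
    (hcurv : IndicatrixPositivelyCurved F S p)
    (hinv : ∀ v : TangentSpace (𝓡 n) p, v ≠ 0 → (⟨p, v⟩ : TangentBundle (𝓡 n) M) ∉ S →
      ∀ i j k : Fin n,
        ∑ l, mixedCurvature (conformalChange α F) p l i j k v * dα α p l =
          ∑ l, mixedCurvature F p l i j k v * dα α p l) :
    (metricStar F α p).PosDef ∧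
    (∀ w : EuclideanSpace ℝ (Fin n),
      energyStar F α p w = (1 / 2) * ∑ i, ∑ j, metricStar F α p i j * w i * w j) ∧
    ∃ K : ℝ, ∀ v : TangentSpace (𝓡 n) p, v ≠ 0 → mfderiv (𝓡 n) 𝓘(ℝ, ℝ) α p v = 0 →
      0 < normStar F α p v ∧
      0 < energyOnLine F α p v 0 ∧
      DifferentiableAt ℝ (energyOnLine F α p v) 0 ∧
      deriv (energyOnLine F α p v) 0 / energyOnLine F α p v 0 = K / normStar F α p v :=
  theorem4_general hn F S hF α p hdα (ℝ ∙ u)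
    ((Nat.add_le_add_right (finrank_span_le_card {u}) 2).trans (by simpa using hn))
    (fun v hv => Submodule.mem_span_singleton.2 ((hS v hv).imp fun _ => Eq.symm)) hinv
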